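/- Let $\Omega = \{0,1\}^{\mathbb N}$ be the Cantor space and let $\mathrm{Homeo}(\Omega)$ be its homeomorphism group with the topology of uniform convergence. For a countable (discrete) group $G$ let $\Xi(G) = \mathrm{Hom}(G, \mathrm{Homeo}(\Omega))$ be the space of all actions of $G$ on $\Omega$ by homeomorphisms, with the subspace topology inherited from $\mathrm{Homeo}(\Omega)^G$. An action $\xi \in \Xi(G)$ is minimal if for every non-empty open $U \subseteq \Omega$ there is a finite $F \subseteq G$ with $\bigcup_{g \in F} \xi(g) U = \Omega$; let $\Xi_{\min}(G) \subseteq \Xi(G)$ be the subspace of minimal actions. The group $\mathrm{Homeo}(\Omega)$ acts on $\Xi(G)$ and on $\Xi_{\min}(G)$ by conjugation, $(f \cdot \xi)(g) = f\,\xi(g)\,f^{-1}$, and the orbits are called conjugacy classes. Let $G$ be a countable amenable group which is not finitely generated. Then no conjugacy class is comeager in $\Xi(G)$. If $G$ is moreover locally finite (every finitely generated subgroup of $G$ is finite), then no conjugacy class of minimal actions is comeager in $\Xi_{\min}(G)$. -/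

import Mathlib

/-- The Cantor space `Ω`, with its product topology. -/
abbrev CantorSpace : Type := ℕ → Bool

/-- The group `Homeo(Ω)`; multiplication is composition, `(f * g) x = f (g x)`. -/
abbrev HomeoCantor : Type := CantorSpace ≃ₜ CantorSpace

/-- The topology of uniform convergence on `Homeo(Ω)`: since `Ω` is compact, it is induced by the
compact-open topology on `C(Ω, Ω)`. -/
instance HomeoCantor.instTopologicalSpace : TopologicalSpace HomeoCantor :=
  TopologicalSpace.induced (fun f : HomeoCantor => (f : C(CantorSpace, CantorSpace))) inferInstance

/-- `Ξ(G) = Hom(G, Homeo(Ω))`, the space of actions of `G` on `Ω` by homeomorphisms. -/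
abbrev ActionSpace (G : Type*) [Group G] : Type _ := G →* HomeoCantor

/-- `Ξ(G)` has the subspace topology of the product `Homeo(Ω)^G`. -/
instance ActionSpace.instTopologicalSpace (G : Type*) [Group G] :
    TopologicalSpace (ActionSpace G) :=
  TopologicalSpace.induced (fun (ξ : ActionSpace G) (g : G) => ξ g) inferInstance

/-- The conjugation action `(f · ξ)(g) = f ξ(g) f⁻¹` of `Homeo(Ω)` on `Ξ(G)`. -/
def ActionSpace.conj {G : Type*} [Group G] (f : HomeoCantor) (ξ : ActionSpace G) :
    ActionSpace G :=
  (MulAut.conj f).toMonoidHom.comp ξ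

/-- The conjugacy class of `ξ`: its orbit under the conjugation action of `Homeo(Ω)`. -/
def ActionSpace.conjClass {G : Type*} [Group G] (ξ : ActionSpace G) : Set (ActionSpace G) :=
  Set.range fun f : HomeoCantor => ActionSpace.conj f ξ

/-- An action on `Ω` is minimal if every non-empty open set is syndetic, i.e. finitely many of its
translates cover `Ω`. -/
def ActionSpace.IsMinimal {G : Type*} [Group G] (ξ : ActionSpace G) : Prop :=
  ∀ U : Set CantorSpace, IsOpen U → U.Nonempty →
    ∃ F : Finset G, ⋃ g ∈ F, ξ g '' U = Set.univ

/-- `Ξ_min(G)`, the space of minimal actions, with the subspace topology. -/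
abbrev MinActionSpace (G : Type*) [Group G] : Type _ :=
  {ξ : ActionSpace G // ξ.IsMinimal}

/-- The conjugacy class of a minimal action, as a subset of `Ξ_min(G)`. -/
def MinActionSpace.conjClass {G : Type*} [Group G] (ξ : MinActionSpace G) :
    Set (MinActionSpace G) :=
  {η | (η : ActionSpace G) ∈ ActionSpace.conjClass (ξ : ActionSpace G)}

/-- A (discrete) group is amenable if it carries a left-invariant finitely additive probability
measure defined on all subsets. -/
def IsAmenableGroup (G : Type*) [Group G] : Prop :=
  ∃ m : Set G → NNReal, m Set.univ = 1 ∧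
    (∀ s t : Set G, Disjoint s t → m (s ∪ t) = m s + m t) ∧
    ∀ (g : G) (s : Set G), m ((fun x => g * x) '' s) = m s

/-- A group is locally finite if all its finitely generated subgroups are finite. -/
def IsLocallyFiniteGroup (G : Type*) [Group G] : Prop :=
  ∀ H : Subgroup G, H.FG → Finite H

/-! For a clopen set `c`, the hitting family of an action consists of the finite `K ⊆ G` that carry
some point into `c`. Conjugation only replaces `c` by another clopen set (`hitFamily_conj`), and
there are countably many of those, so a conjugacy class realizes countably many hitting families of
`c`. Fixing the family is a closed condition; by Baire, a comeager class makes it locally constant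
on a dense open set. It therefore suffices to find a nonempty open set of actions, and a `c`, such
that the family of `c` varies arbitrarily close to each of these actions.

To perturb `ξ`, only a finite `F ⊆ G` and finitely many coordinates matter: any Cantor system with a
map to `Ω` that is equivariant along `F` and meets all cylinders of a given length is conjugate to
an action near `ξ` (`exists_realization`). Spaces coinduced from `H = ⟨F⟩` supply such systems.

If `G` is not locally finite, Hall's theorem gives an action compressing `Ω` off some `c` by a
piecewise translation. This persists nearby, and amenability then yields an orbit avoiding `c`. As
`H ≠ G`, the coinduced space and its subspace of points visiting `c` along at most one coset have
different families.

If `G` is locally finite, `H` lies in finite subgroups `Γ` of large index over `H`. Counting gives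
two `H`-maps on `Γ` distinguished by one finite set (`exists_equivariant_pair`), which are pulled
back to any system with an equivariant map to `Γ`. Such systems may be chosen minimal, which settles
`Ξ_min(G)` as well. -/

open Topology Filter Set

/-! ### Brouwer's characterization of the Cantor space, with prescribed coordinates -/

/-- A clopen subset of a clopen set `U` whose traces on both sides are nonempty, equal to `C ∩ U`
when possible. -/
theorem exists_clopen_split {M : Type*} [TopologicalSpace M] [CompactSpace M] [T2Space M]
    [TotallyDisconnectedSpace M] (hM : ∀ U : Set M, IsOpen U → U.Nonempty → U.Nontrivial)
    (C : Set M) (hC : IsClopen C) (U : Set M) : ∃ S : Set M, IsClopen S ∧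
      (IsClopen U → U.Nonempty → (U ∩ S).Nonempty ∧ (U ∩ Sᶜ).Nonempty ∧
        (U ∩ C = ∅ ∨ U ∩ Cᶜ = ∅ ∨ S = C)) := by
  by_cases hU : IsClopen U ∧ U.Nonempty
  swap
  · exact ⟨∅, isClopen_empty, fun h1 h2 => absurd ⟨h1, h2⟩ hU⟩
  by_cases hs : (U ∩ C).Nonempty ∧ (U ∩ Cᶜ).Nonempty
  · exact ⟨C, hC, fun _ _ => ⟨hs.1, hs.2, Or.inr (Or.inr rfl)⟩⟩
  · obtain ⟨x, hx, y, hy, hxy⟩ := hM U hU.1.isOpen hU.2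
    obtain ⟨S, hS, hxS, hyS⟩ := exists_isClopen_of_totally_separated hxy
    refine ⟨S, hS, fun _ _ => ⟨⟨x, hx, hxS⟩, ⟨y, hy, hyS⟩, ?_⟩⟩
    rcases not_and_or.1 hs with h | h
    · exact Or.inl (not_nonempty_iff_eq_empty.1 h)
    · exact Or.inr (Or.inl (not_nonempty_iff_eq_empty.1 h))

section Scheme

open Classical in
/-- The cell of level `i` containing `x`, for the splitting rule `S`. -/
noncomputable def splitCell {M : Type*} (S : ℕ → Set M → Set M) (x : M) : ℕ → Set M
  | 0 => univ
  | i + 1 => splitCell S x i ∩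
      (if x ∈ S i (splitCell S x i) then S i (splitCell S x i) else (S i (splitCell S x i))ᶜ)

open Classical in
/-- The itinerary of `x` along the splitting rule `S`. -/
noncomputable def splitCode {M : Type*} (S : ℕ → Set M → Set M) (x : M) : CantorSpace :=
  fun i => decide (x ∈ S i (splitCell S x i))

/-- The cell of level `i` with itinerary `a`. -/
def codeCell {M : Type*} (S : ℕ → Set M → Set M) (a : CantorSpace) : ℕ → Set M
  | 0 => univ
  | i + 1 => codeCell S a i ∩
      (if a i = true then S i (codeCell S a i) else (S i (codeCell S a i))ᶜ)

variable {M : Type*} (S : ℕ → Set M → Set M)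

theorem mem_splitCell (x : M) (i : ℕ) : x ∈ splitCell S x i := by
  induction i with
  | zero => trivial
  | succ i ih =>
    refine ⟨ih, ?_⟩
    split_ifs with h
    · exact h
    · exact h

theorem splitCell_eq_codeCell (x : M) (a : CantorSpace) (i : ℕ)
    (h : ∀ j < i, splitCode S x j = a j) : splitCell S x i = codeCell S a i := by
  classical
  induction i with
  | zero => rfl
  | succ i ih =>
    have h1 := ih fun j hj => h j (by omega)
    have h2 : decide (x ∈ S i (splitCell S x i)) = a i := h i (by omega)
    simp only [splitCell, codeCell]
    rw [h1] at h2 ⊢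
    rw [← h2]
    by_cases hx : x ∈ S i (codeCell S a i) <;> simp [hx]

theorem mem_codeCell_iff (x : M) (a : CantorSpace) (i : ℕ) :
    x ∈ codeCell S a i ↔ ∀ j < i, splitCode S x j = a j := by
  classical
  constructor
  · intro hx
    induction i with
    | zero => intro j hj; omega
    | succ i ih =>
      have h1 := ih hx.1
      intro j hj
      rcases Nat.lt_succ_iff_lt_or_eq.1 hj with hj | rfl
      · exact h1 j hj
      · have h2 := hx.2
        have h3 := splitCell_eq_codeCell S x a j h1
        change decide (x ∈ S j (splitCell S x j)) = a j
        rw [h3]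
        cases ha : a j
        · simpa [ha] using h2
        · simpa [ha] using h2
  · intro h
    rw [← splitCell_eq_codeCell S x a i h]
    exact mem_splitCell S x i

end Scheme

/-- Every compact totally disconnected Hausdorff second countable space without isolated points
is homeomorphic to the Cantor space, and the homeomorphism may be chosen to agree on the first `n`
coordinates with any continuous map that meets all cylinders of length `n`. -/
theorem exists_homeomorph_cantorSpace {M : Type*} [TopologicalSpace M] [CompactSpace M] [T2Space M]
    [TotallyDisconnectedSpace M] [SecondCountableTopology M]
    (hM : ∀ U : Set M, IsOpen U → U.Nonempty → U.Nontrivial)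
    (p : M → CantorSpace) (hp : Continuous p) (n : ℕ)
    (hd : ∀ a : CantorSpace, ∃ m, ∀ i < n, p m i = a i) :
    ∃ φ : M ≃ₜ CantorSpace, ∀ m, ∀ i < n, φ m i = p m i := by
  have : Countable (TopologicalSpace.Clopens M) :=
    TopologicalSpace.Clopens.countable_iff_secondCountable.2 inferInstance
  obtain ⟨e, he⟩ := exists_surjective_nat (TopologicalSpace.Clopens M)
  -- The first `n` cuts are the coordinates of `p`, so that the code agrees with `p` there; the
  -- later ones run through all clopen sets, so that the code separates points.
  let C : ℕ → Set M := fun i => if i < n then {m | p m i = true} else e (i - n)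
  have hC : ∀ i, IsClopen (C i) := by
    intro i
    by_cases hi : i < n
    · simp only [C, hi, if_true]
      exact (isClopen_discrete {true}).preimage ((continuous_apply i).comp hp)
    · simp only [C, hi, if_false]
      exact (e (i - n)).isClopen
  choose S hS hS' using fun i => exists_clopen_split hM (C i) (hC i)
  have hne : Nonempty M := ⟨(hd fun _ => true).choose⟩
  have hcl : ∀ a i, IsClopen (codeCell S a i) ∧ (codeCell S a i).Nonempty := by
    intro a i
    induction i with
    | zero => exact ⟨isClopen_univ, univ_nonempty⟩
    | succ i ih =>
      obtain ⟨h1, h2, -⟩ := hS' i _ ih.1 ih.2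
      simp only [codeCell]
      split_ifs with h
      · exact ⟨ih.1.inter (hS _ _), h1⟩
      · exact ⟨ih.1.inter (hS _ _).compl, h2⟩
  have hcont : Continuous (splitCode S) := by
    refine continuous_pi fun i => ?_
    rw [continuous_discrete_rng]
    intro b
    rw [isOpen_iff_mem_nhds]
    intro x hx
    filter_upwards [(hcl (splitCode S x) (i + 1)).1.isOpen.mem_nhds
      ((mem_codeCell_iff S _ _ _).2 fun _ _ => rfl)] with y hy
    have := (mem_codeCell_iff S _ _ _).1 hy i (by omega)
    simp only [mem_preimage, mem_singleton_iff] at hx ⊢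
    rw [this, hx]
  have hinj : Function.Injective (splitCode S) := by
    intro x y hxy
    by_contra hne
    obtain ⟨U, hU, hxU, hyU⟩ := exists_isClopen_of_totally_separated hne
    obtain ⟨k, hk⟩ := he ⟨U, hU⟩
    have hCk : C (k + n) = U := by
      simp [C, hk]
    set a := splitCode S x with ha
    have hx : x ∈ codeCell S a (k + n + 1) := (mem_codeCell_iff S _ _ _).2 fun _ _ => rfl
    have hy : y ∈ codeCell S a (k + n + 1) := (mem_codeCell_iff S _ _ _).2 fun _ _ => by rw [hxy]
    have h3 := (hS' (k + n) _ (hcl a (k + n)).1 (hcl a (k + n)).2).2.2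
    rw [hCk] at h3
    rcases h3 with h3 | h3 | h3
    · exact (h3.subset ⟨hx.1, hxU⟩ : x ∈ (∅ : Set M))
    · exact (h3.subset ⟨hy.1, hyU⟩ : y ∈ (∅ : Set M))
    · have hx2 := hx.2
      have hy2 := hy.2
      rw [h3] at hx2 hy2
      split_ifs at hx2 hy2 with h
      · exact hyU hy2
      · exact hx2 hxU
  have hsurj : Function.Surjective (splitCode S) := by
    intro a
    have := IsCompact.nonempty_iInter_of_sequence_nonempty_isCompact_isClosed (codeCell S a)
      (fun i => inter_subset_left) (fun i => (hcl a i).2) (hcl a 0).1.isClosed.isCompact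
      (fun i => (hcl a i).1.isClosed)
    obtain ⟨x, hx⟩ := this
    refine ⟨x, funext fun i => ?_⟩
    exact (mem_codeCell_iff S _ _ _).1 (mem_iInter.1 hx (i + 1)) i (by omega)
  have hagree : ∀ m, ∀ i < n, splitCode S m i = p m i := by
    have key : ∀ i ≤ n, ∀ m, ∀ j < i, splitCode S m j = p m j := by
      intro i
      induction i with
      | zero => intro _ m j hj; omega
      | succ i ih =>
        intro hi m j hj
        have h1 := ih (by omega)
        rcases Nat.lt_succ_iff_lt_or_eq.1 hj with hj | rfl
        · exact h1 m j hj
        · have h2 : splitCell S m j = codeCell S (p m) j :=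
            splitCell_eq_codeCell S m _ j (h1 m)
          have hmem : ∀ x, x ∈ codeCell S (p m) j ↔ ∀ i < j, p x i = p m i := by
            intro x
            rw [mem_codeCell_iff]
            exact forall₂_congr fun i hi => by rw [h1 x i hi]
          have hCj : C j = {x | p x j = true} := by
            simp only [C, if_pos (show j < n by omega)]
          -- By `hd` the cell contains points with either value of coordinate `j`, so `C j` really
          -- cuts it and the rule must select `C j`.
          have hSj : S j (codeCell S (p m) j) = C j := by
            rcases (hS' j _ (hcl (p m) j).1 (hcl (p m) j).2).2.2 with h3 | h3 | h3
            · obtain ⟨x, hx⟩ := hd (Function.update (p m) j true)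
              refine absurd (h3.subset ⟨(hmem x).2 fun i hi => ?_, ?_⟩ : x ∈ (∅ : Set M)) id
              · rw [hx i (by omega), Function.update_of_ne (by omega)]
              · rw [hCj, mem_ofPred_eq, hx j (by omega), Function.update_self]
            · obtain ⟨x, hx⟩ := hd (Function.update (p m) j false)
              refine absurd (h3.subset ⟨(hmem x).2 fun i hi => ?_, ?_⟩ : x ∈ (∅ : Set M)) id
              · rw [hx i (by omega), Function.update_of_ne (by omega)]
              · rw [hCj, mem_compl_iff, mem_ofPred_eq, hx j (by omega), Function.update_self]
                simp
            · exact h3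
          simp only [splitCode, h2, hSj, hCj, mem_ofPred_eq]
          simp
    exact fun m i hi => key n le_rfl m i hi
  refine ⟨Continuous.homeoOfEquivCompactToT2 (f := Equiv.ofBijective _ ⟨hinj, hsurj⟩) hcont, ?_⟩
  exact hagree

/-! ### Cylinders and uniform continuity -/

theorem exists_cylinder_of_mem_uniformity {V : Set (CantorSpace × CantorSpace)}
    (hV : V ∈ uniformity CantorSpace) :
    ∃ n : ℕ, ∀ x y : CantorSpace, (∀ i < n, x i = y i) → (x, y) ∈ V := by
  rw [Pi.uniformity, Filter.mem_iInf] at hV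
  obtain ⟨I, hI, U, hU, rfl⟩ := hV
  obtain ⟨n, hn⟩ := hI.bddAbove
  refine ⟨n + 1, fun x y hxy => mem_iInter.2 fun i => ?_⟩
  obtain ⟨t, ht, htU⟩ := Filter.mem_comap.1 (hU i)
  refine htU ?_
  simp only [mem_preimage, hxy i (Nat.lt_succ_of_le (hn i.2))]
  exact refl_mem_uniformity ht

theorem cylinder_mem_uniformity (n : ℕ) :
    {q : CantorSpace × CantorSpace | ∀ i < n, q.1 i = q.2 i} ∈ uniformity CantorSpace := by
  have : {q : CantorSpace × CantorSpace | ∀ i < n, q.1 i = q.2 i} =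
      ⋂ i ∈ Iio n, {q : CantorSpace × CantorSpace | q.1 i = q.2 i} := by
    ext; simp
  rw [this, Filter.biInter_mem (finite_Iio n)]
  intro i _
  have h := (Pi.uniformContinuous_proj (fun _ : ℕ => Bool) i) 
    (show {q : Bool × Bool | q.1 = q.2} ∈ uniformity Bool by
      rw [DiscreteUniformity.eq_principal_setRelId]; exact fun q hq => hq)
  exact h

theorem exists_cylinder_of_continuous {f : CantorSpace → CantorSpace} (hf : Continuous f) (n : ℕ) :
    ∃ k : ℕ, ∀ x y : CantorSpace, (∀ i < k, x i = y i) → ∀ i < n, f x i = f y i :=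
  exists_cylinder_of_mem_uniformity
    (CompactSpace.uniformContinuous_of_continuous hf (cylinder_mem_uniformity n))

theorem exists_cylinder_of_isClopen {c : Set CantorSpace} (hc : IsClopen c) :
    ∃ n : ℕ, ∀ x y : CantorSpace, (∀ i < n, x i = y i) → (x ∈ c ↔ y ∈ c) := by
  classical
  have hf : Continuous fun x => (fun _ : ℕ => decide (x ∈ c) : CantorSpace) :=
    continuous_pi fun _ => (IsLocallyConstant.continuous <| by
      rw [IsLocallyConstant.iff_eventually_eq]
      intro x
      by_cases hx : x ∈ c
      · filter_upwards [hc.isOpen.mem_nhds hx] with y hy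
        simp [hx, hy]
      · filter_upwards [hc.compl.isOpen.mem_nhds hx] with y hy
        simp only [mem_compl_iff] at hy
        simp [hx, hy])
  obtain ⟨k, hk⟩ := exists_cylinder_of_continuous hf 1
  exact ⟨k, fun x y h => by simpa using hk x y h 0 (by omega)⟩

/-! ### The topology of the space of actions -/

namespace ActionSpace

variable {G : Type*} [Group G]

/-- The embedding of `Ξ(G)` into a product of spaces of continuous maps. -/
def toMaps (ξ : ActionSpace G) : G → C(CantorSpace, CantorSpace) := fun g => (ξ g : HomeoCantor)

theorem isInducing_toMaps : IsInducing (toMaps (G := G)) := by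
  have h1 : IsInducing fun (f : G → HomeoCantor) (g : G) => (f g : C(CantorSpace, CantorSpace)) :=
    IsInducing.piMap (f := fun (_ : G) (f : HomeoCantor) => (f : C(CantorSpace, CantorSpace)))
      fun _ => ⟨rfl⟩
  have h2 : IsInducing fun (ξ : ActionSpace G) (g : G) => ξ g := ⟨rfl⟩
  exact h1.comp h2

theorem toMaps_injective : Function.Injective (toMaps (G := G)) := by
  intro ξ η h
  ext g x : 2
  exact DFunLike.congr_fun (congrFun h g) x

/-- Preserving `1` and products already makes `f g⁻¹` inverse to `f g`, so invertibility need not be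
imposed and the conditions are closed. -/
theorem range_toMaps : range (toMaps (G := G)) =
    {f | f 1 = ContinuousMap.id _} ∩ ⋂ g, ⋂ h, {f | f (g * h) = (f g).comp (f h)} := by
  ext f
  constructor
  · rintro ⟨ξ, rfl⟩
    refine ⟨?_, ?_⟩
    · ext1 x
      simp [toMaps]
    · simp only [mem_iInter]
      intro g h
      ext1 x
      simp [toMaps]
  · rintro ⟨h1, h2⟩
    simp only [mem_iInter] at h2
    have h1' : ∀ x, f 1 x = x := fun x => DFunLike.congr_fun h1 x
    have h2' : ∀ g h x, f (g * h) x = f g (f h x) := fun g h x => DFunLike.congr_fun (h2 g h) x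
    let F : G → HomeoCantor := fun g =>
      { toFun := f g
        invFun := f g⁻¹
        left_inv := fun x => by rw [← h2', inv_mul_cancel, h1']
        right_inv := fun x => by rw [← h2', mul_inv_cancel, h1']
        continuous_toFun := (f g).continuous
        continuous_invFun := (f g⁻¹).continuous }
    refine ⟨MonoidHom.mk' F fun g h => Homeomorph.ext fun x => h2' g h x, ?_⟩
    ext1 g
    ext1 x
    rfl

theorem isClosedEmbedding_toMaps : IsClosedEmbedding (toMaps (G := G)) := by
  refine ⟨⟨isInducing_toMaps, toMaps_injective⟩, ?_⟩
  rw [range_toMaps]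
  refine (isClosed_eq (continuous_apply _) continuous_const).inter
    (isClosed_iInter fun g => isClosed_iInter fun h => isClosed_eq (continuous_apply _) ?_)
  exact (continuous_apply g).compCM (continuous_apply h)

instance instIsCompletelyMetrizableSpace [Countable G] :
    TopologicalSpace.IsCompletelyMetrizableSpace (ActionSpace G) :=
by
  have : (uniformity Bool).IsCountablyGenerated := by
    rw [DiscreteUniformity.eq_principal_setRelId]
    exact Filter.isCountablyGenerated_principal _
  exact isClosedEmbedding_toMaps.IsCompletelyMetrizableSpace

/-- `c` and its complement are open with compact preimages under `ξ g`, so mapping each preimage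
into its target is open in the compact-open topology. -/
theorem eventually_mem_iff (ξ : ActionSpace G) (g : G) {c : Set CantorSpace} (hc : IsClopen c) :
    ∀ᶠ η in 𝓝 ξ, ∀ x, η g x ∈ c ↔ ξ g x ∈ c := by
  have hcont : Continuous fun η : ActionSpace G => toMaps η g :=
    (continuous_apply g).comp isInducing_toMaps.continuous
  have hcl : IsClopen (ξ g ⁻¹' c) := hc.preimage (ξ g).continuous
  have h1 := (ContinuousMap.isOpen_setOfPred_mapsTo hcl.isClosed.isCompact hc.isOpen).preimage hcont
  have h2 := (ContinuousMap.isOpen_setOfPred_mapsTo hcl.compl.isClosed.isCompact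
    hc.compl.isOpen).preimage hcont
  filter_upwards [h1.mem_nhds (show MapsTo _ _ _ from fun x hx => hx),
    h2.mem_nhds (show MapsTo _ _ _ from fun x hx => hx)] with η h3 h4 x
  exact ⟨fun h => by_contra fun h' => h4 h' h, fun h => h3 h⟩

/-- The action on the Cantor space carried over from `M` along a homeomorphism. -/
def transport {M : Type*} [TopologicalSpace M] [MulAction G M] [ContinuousConstSMul G M]
    (φ : M ≃ₜ CantorSpace) : ActionSpace G :=
  MonoidHom.mk' (fun g => (φ.symm.trans (Homeomorph.smul g)).trans φ) fun g h => by
    ext1 x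
    simp [mul_smul]

theorem transport_apply {M : Type*} [TopologicalSpace M] [MulAction G M] [ContinuousConstSMul G M]
    (φ : M ≃ₜ CantorSpace) (g : G) (x : CantorSpace) :
    transport φ g x = φ (g • φ.symm x) := rfl

/-- An action transported along a homeomorphism close to an approximately equivariant map is close
to the target action. -/
theorem exists_transport_mem (ξ : ActionSpace G) {N : Set (ActionSpace G)} (hN : N ∈ 𝓝 ξ) :
    ∃ (F : Finset G) (n : ℕ), ∀ (M : Type*) [TopologicalSpace M] [MulAction G M]
      [ContinuousConstSMul G M] (φ : M ≃ₜ CantorSpace) (p : M → CantorSpace),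
      (∀ m, ∀ i < n, φ m i = p m i) → (∀ g ∈ F, ∀ m, p (g • m) = ξ g (p m)) →
        transport φ ∈ N := by
  rw [isInducing_toMaps.nhds_eq_comap, Filter.mem_comap] at hN
  obtain ⟨t, ht, htN⟩ := hN
  rw [nhds_pi, Filter.mem_pi] at ht
  obtain ⟨I, hI, t', ht', hst⟩ := ht
  have key : ∀ g : G, ∃ k : ℕ, ∀ f : C(CantorSpace, CantorSpace),
      (∀ x, ∀ i < k, ξ g x i = f x i) → f ∈ t' g := by
    intro g
    obtain ⟨E, hE, hE'⟩ := UniformSpace.mem_nhds_iff.1 (ht' g)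
    obtain ⟨V, hV, hVE⟩ :=
      (ContinuousMap.hasBasis_compactConvergenceUniformity_of_compact.mem_iff).1 hE
    obtain ⟨k, hk⟩ := exists_cylinder_of_mem_uniformity hV
    exact ⟨k, fun f hf => hE' (hVE fun x => hk _ _ (hf x))⟩
  choose k hk using key
  choose l hl using fun g => exists_cylinder_of_continuous (ξ g).continuous (k g)
  -- Here `k g` coordinates compare `φ` with `p` after applying `g`, and `l g` coordinates compare
  -- them before, where continuity of `ξ g` transfers the agreement.
  refine ⟨hI.toFinset, hI.toFinset.sup fun g => max (k g) (l g), fun M _ _ _ φ p hφ hp => ?_⟩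
  refine htN (hst fun g hg => hk g _ fun x i hi => ?_)
  have hgF : g ∈ hI.toFinset := hI.mem_toFinset.2 hg
  have hle := Finset.le_sup (f := fun g => max (k g) (l g)) hgF
  change ξ g x i = φ (g • φ.symm x) i
  rw [hφ _ i (lt_of_lt_of_le hi (le_trans (le_max_left _ _) hle)), hp g hgF]
  refine hl g _ _ (fun j hj => ?_) i hi
  rw [← hφ _ j (lt_of_lt_of_le hj (le_trans (le_max_right _ _) hle)), φ.apply_symm_apply]

/-! ### Hitting families and the category argument -/

/-- The finite sets `K` for which some point is moved into `c` by all elements of `K`. -/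
def hitFamily (c : Set CantorSpace) (ξ : ActionSpace G) : Set (Finset G) :=
  {K | ∃ x, ∀ k ∈ K, ξ k x ∈ c}

theorem hitFamily_conj (f : HomeoCantor) (ξ : ActionSpace G) (c : Set CantorSpace) :
    hitFamily c (conj f ξ) = hitFamily (f ⁻¹' c) ξ := by
  ext K
  constructor
  · rintro ⟨x, hx⟩
    exact ⟨f⁻¹ x, fun k hk => hx k hk⟩
  · rintro ⟨x, hx⟩
    refine ⟨f x, fun k hk => ?_⟩
    have h : conj f ξ k (f x) = f (ξ k x) := by
      change f (ξ k (f.symm (f x))) = _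
      rw [f.symm_apply_apply]
    rw [h]
    exact hx k hk

/-- A difference from `T` is witnessed by a single finite `K`, whose membership depends on finitely
many locally constant clopen conditions. -/
theorem isClosed_hitFamily_eq {c : Set CantorSpace} (hc : IsClopen c) (T : Set (Finset G)) :
    IsClosed {ξ : ActionSpace G | hitFamily c ξ = T} := by
  rw [← isOpen_compl_iff, isOpen_iff_mem_nhds]
  intro ξ hξ
  obtain ⟨K, hK⟩ : ∃ K, ¬ (K ∈ hitFamily c ξ ↔ K ∈ T) := by
    by_contra! h
    exact hξ (Set.ext h)
  have : ∀ᶠ η in 𝓝 ξ, ∀ k ∈ K, ∀ x, η k x ∈ c ↔ ξ k x ∈ c :=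
    (Finset.eventually_all K).2 fun k _ => eventually_mem_iff ξ k hc
  filter_upwards [this] with η hη hT
  refine hK ?_
  rw [← (show hitFamily c η = T from hT)]
  exact exists_congr fun x => forall₂_congr fun k hk => (hη k hk x).symm

/-- If a conjugacy class is comeager then the hitting families of a given clopen set are locally
constant on a dense open set. -/
theorem exists_open_hitFamily_const {X : Type*} [TopologicalSpace X] [BaireSpace X]
    {i : X → ActionSpace G} (hi : Continuous i) {ξ : ActionSpace G}
    (hξ : i ⁻¹' conjClass ξ ∈ residual X) {c : Set CantorSpace} (hc : IsClopen c) {N : Set X}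
    (hN : IsOpen N) (hne : N.Nonempty) :
    ∃ N' ⊆ N, IsOpen N' ∧ N'.Nonempty ∧
      ∀ x ∈ N', ∀ y ∈ N', hitFamily c (i x) = hitFamily c (i y) := by
  have : Countable (TopologicalSpace.Clopens CantorSpace) :=
    TopologicalSpace.Clopens.countable_iff_secondCountable.2 inferInstance
  obtain ⟨t, htξ, htG, htd⟩ := mem_residual.1 hξ
  -- These countably many closed sets, one for each clopen `d`, cover a dense `Gδ` set, so their
  -- interiors have dense union.
  have hdense := htG.dense_iUnion_interior_of_closed htd
    (f := fun d : TopologicalSpace.Clopens CantorSpace => i ⁻¹' {η | hitFamily c η = hitFamily d ξ})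
    (fun d => (isClosed_hitFamily_eq hc _).preimage hi) (by
      intro x hx
      obtain ⟨f, hf⟩ := htξ hx
      refine mem_iUnion.2 ⟨⟨f ⁻¹' c, hc.preimage f.continuous⟩, ?_⟩
      change hitFamily c (i x) = _
      rw [← hf]
      exact hitFamily_conj f ξ c)
  obtain ⟨x, hxN, hx⟩ := hdense.inter_open_nonempty N hN hne
  obtain ⟨d, hd⟩ := mem_iUnion.1 hx
  refine ⟨_, inter_subset_left, hN.inter (isOpen_interior
    (s := i ⁻¹' {η | hitFamily c η = hitFamily d ξ})),
    ⟨x, hxN, hd⟩, ?_⟩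
  intro y hy z hz
  have h1 : hitFamily c (i y) = hitFamily d ξ := interior_subset (s := i ⁻¹' _) hy.2
  have h2 : hitFamily c (i z) = hitFamily d ξ := interior_subset (s := i ⁻¹' _) hz.2
  rw [h1, h2]

end ActionSpace

/-! ### The Baire property for minimal actions -/

theorem IsGδ.baireSpace_subtype {X : Type*} [TopologicalSpace X]
    [TopologicalSpace.IsCompletelyMetrizableSpace X]
    {s : Set X} (hs : IsGδ s) : BaireSpace s := by
  have : TopologicalSpace.IsCompletelyMetrizableSpace (closure s) :=
    isClosed_closure.isClosedEmbedding_subtypeVal.IsCompletelyMetrizableSpace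
  let s' : Set (closure s) := Subtype.val ⁻¹' s
  have h1 : IsGδ s' := hs.preimage continuous_subtype_val
  have h2 : Dense s' := by
    rw [Subtype.dense_iff]
    intro x hx
    rwa [Subtype.image_preimage_coe, inter_eq_right.2 subset_closure]
  have := h1.baireSpace_of_dense h2
  let e : s ≃ₜ s' :=
    { toFun := fun x => ⟨⟨x, subset_closure x.2⟩, x.2⟩
      invFun := fun x => ⟨x.1.1, x.2⟩
      left_inv := fun _ => rfl
      right_inv := fun _ => rfl
      continuous_toFun := by fun_prop
      continuous_invFun := by fun_prop }
  exact e.isOpenEmbedding.baireSpace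

/-- Minimality need only be tested on the countably many nonempty clopen sets, and each test is an
open condition; minimal actions thus form a `Gδ` set. -/
instance MinActionSpace.instBaireSpace {G : Type*} [Group G] [Countable G] :
    BaireSpace (MinActionSpace G) := by
  have : Countable (TopologicalSpace.Clopens CantorSpace) :=
    TopologicalSpace.Clopens.countable_iff_secondCountable.2 inferInstance
  have heq : {ξ : ActionSpace G | ξ.IsMinimal} =
      ⋂ U : {U : TopologicalSpace.Clopens CantorSpace // (U : Set CantorSpace).Nonempty},
        {ξ | ∃ F : Finset G, ⋃ g ∈ F, ξ g '' (U : Set CantorSpace) = univ} := by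
    ext ξ
    simp only [mem_iInter]
    constructor
    · intro h U
      exact h U U.1.isClopen.isOpen U.2
    · intro h U hU hne
      obtain ⟨x, hx⟩ := hne
      obtain ⟨V, hV, hxV, hVU⟩ := compact_exists_isClopen_in_isOpen hU hx
      obtain ⟨F, hF⟩ := h ⟨⟨V, hV⟩, ⟨x, hxV⟩⟩
      refine ⟨F, univ_subset_iff.1 (hF ▸ ?_)⟩
      exact iUnion₂_mono fun g _ => image_mono hVU
  have hG : IsGδ {ξ : ActionSpace G | ξ.IsMinimal} := by
    rw [heq]
    refine IsGδ.iInter_of_isOpen fun U => isOpen_iff_mem_nhds.2 ?_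
    rintro ξ ⟨F, hF⟩
    have : ∀ᶠ η in 𝓝 ξ, ∀ g ∈ F, ∀ x,
        η g⁻¹ x ∈ (U : Set CantorSpace) ↔ ξ g⁻¹ x ∈ (U : Set CantorSpace) :=
      (Finset.eventually_all F).2 fun g _ => ActionSpace.eventually_mem_iff ξ g⁻¹ U.1.isClopen
    filter_upwards [this] with η hη
    refine ⟨F, hF ▸ ?_⟩
    refine iUnion₂_congr fun g hg => ?_
    have himg : ∀ (ζ : ActionSpace G), ζ g '' (U : Set CantorSpace) = ζ g⁻¹ ⁻¹' U := by
      intro ζ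
      rw [map_inv]
      exact (ζ g).toEquiv.image_eq_preimage_symm _
    rw [himg, himg]
    exact Set.ext (hη g hg)
  exact hG.baireSpace_subtype

theorem CantorSpace.nontrivial_of_isOpen {U : Set CantorSpace} (hU : IsOpen U) (hne : U.Nonempty) :
    U.Nontrivial := by
  obtain ⟨x, hx⟩ := hne
  obtain ⟨V, hV, hxV, hVU⟩ := compact_exists_isClopen_in_isOpen hU hx
  obtain ⟨n, hn⟩ := exists_cylinder_of_isClopen hV
  refine ⟨x, hx, Function.update x n (!x n), hVU ((hn x _ fun i hi => ?_).1 hxV), fun h => ?_⟩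
  · rw [Function.update_of_ne (by omega)]
  · have := congrFun h n
    simp at this

/-! ### Shifts and coinduced spaces -/

/-- The Cantor space regarded as a `G`-space through the action `ξ`. -/
def ActedSpace {G : Type*} [Group G] (_ : ActionSpace G) : Type := CantorSpace

namespace ActedSpace

variable {G : Type*} [Group G] (ξ : ActionSpace G)

instance : TopologicalSpace (ActedSpace ξ) := inferInstanceAs (TopologicalSpace CantorSpace)
instance : CompactSpace (ActedSpace ξ) := inferInstanceAs (CompactSpace CantorSpace)
instance : T2Space (ActedSpace ξ) := inferInstanceAs (T2Space CantorSpace)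
instance : TotallyDisconnectedSpace (ActedSpace ξ) :=
  inferInstanceAs (TotallyDisconnectedSpace CantorSpace)
instance : SecondCountableTopology (ActedSpace ξ) :=
  inferInstanceAs (SecondCountableTopology CantorSpace)

instance : MulAction G (ActedSpace ξ) where
  smul g x := ξ g x
  one_smul x := by
    change ξ 1 x = x
    rw [map_one]
    rfl
  mul_smul g h x := by
    change ξ (g * h) x = ξ g (ξ h x)
    rw [map_mul]
    rfl

instance : ContinuousConstSMul G (ActedSpace ξ) := ⟨fun g => (ξ g).continuous⟩

instance (H : Subgroup G) : ContinuousConstSMul H (ActedSpace ξ) := ⟨fun h => (ξ h).continuous⟩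

end ActedSpace

/-- A product with the Cantor space has no isolated points. -/
theorem nontrivial_of_isOpen_prod {X : Type*} [TopologicalSpace X] {G : Type*} [Group G]
    {ξ : ActionSpace G} {U : Set (X × ActedSpace ξ)}
    (hU : IsOpen U) (hne : U.Nonempty) : U.Nontrivial := by
  obtain ⟨⟨x, y⟩, h⟩ := hne
  obtain ⟨a, ha, b, hb, hab⟩ := CantorSpace.nontrivial_of_isOpen (U := {y | (x, y) ∈ U})
    (hU.preimage (Continuous.prodMk_right (Y := ActedSpace ξ) x)) ⟨y, h⟩
  exact ⟨(x, a), ha, (x, b), hb, fun h => hab (congrArg Prod.snd h)⟩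

/-- A closed subset of `G → A` invariant under right translations. -/
structure Shift (G A : Type*) [Group G] [TopologicalSpace A] where
  carrier : Set (G → A)
  isClosed : IsClosed carrier
  translate_mem : ∀ w ∈ carrier, ∀ γ : G, (fun g => w (g * γ)) ∈ carrier

namespace Shift

variable {G A : Type*} [Group G] [TopologicalSpace A] (Y : Shift G A)

instance : MulAction G Y.carrier where
  smul γ w := ⟨fun g => w.1 (g * γ), Y.translate_mem w.1 w.2 γ⟩
  one_smul w := Subtype.ext (funext fun g => congrArg w.1 (mul_one g))
  mul_smul γ δ w := Subtype.ext (funext fun g => congrArg w.1 (mul_assoc g γ δ).symm)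

instance : ContinuousConstSMul G Y.carrier :=
  ⟨fun γ => Continuous.subtype_mk (f := fun w : Y.carrier => fun g => w.1 (g * γ))
    (continuous_pi fun g => (continuous_apply (g * γ)).comp continuous_subtype_val) _⟩

instance [CompactSpace A] : CompactSpace Y.carrier :=
  isCompact_iff_compactSpace.1 Y.isClosed.isCompact

end Shift

section Coinduction

variable {G A : Type*} [Group G] [TopologicalSpace A] [T2Space A] (H : Subgroup G) [MulAction H A]
  [ContinuousConstSMul H A]

/-- The `G`-space coinduced from the `H`-space `A`. -/
def coind : Shift G A where
  carrier := {w | ∀ (h : H) (g : G), w (h * g) = h • w g}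
  isClosed := by
    simp only [ofPred_forall]
    exact isClosed_iInter fun h => isClosed_iInter fun g =>
      isClosed_eq (continuous_apply _) ((continuous_apply g).const_smul h)
  translate_mem w hw γ h g := by
    change w (h * g * γ) = h • w (g * γ)
    rw [mul_assoc, hw]

/-- This makes evaluation at `1` an `H`-map to `A`, the source of the approximate factor maps used
below. -/
theorem smul_apply_one_of_mem_coind {w : G → A} (hw : w ∈ (coind (A := A) H).carrier) (h : H) :
    w h = h • w 1 := by
  rw [← hw h 1, mul_one]

variable {H}

/-- Values on a right transversal of `H` determine an equivariant map. -/
noncomputable def extendTransversal {B : Type*} [MulAction H B] {T : Set G}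
    (hT : Subgroup.IsComplement (H : Set G) T) (y : T → B) : G → B :=
  fun g => (⟨(hT.equiv g).1, (hT.equiv g).1.2⟩ : H) • y (hT.equiv g).2

/-- Equivariant maps thus amount to one free choice of value per coset, which is the freedom
exploited by the perturbations. -/
theorem extendTransversal_mul {B : Type*} [MulAction H B] {T : Set G}
    (hT : Subgroup.IsComplement (H : Set G) T) (y : T → B) (h : H) (g : G) :
    extendTransversal hT y (h * g) = h • extendTransversal hT y g := by
  unfold extendTransversal
  rw [smul_smul]
  have h1 := hT.equiv_mul_left h g
  have h2 : (hT.equiv (h * g)).2 = (hT.equiv g).2 := by rw [h1]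
  have h3 : (⟨(hT.equiv (h * g)).1, (hT.equiv (h * g)).1.2⟩ : H) =
      h * ⟨(hT.equiv g).1, (hT.equiv g).1.2⟩ := by
    ext
    rw [h1]
    rfl
  rw [h2, h3]

theorem equiv_coe_transversal {T : Set G} (hT : Subgroup.IsComplement (H : Set G) T) (t : T) :
    hT.equiv (t : G) = (⟨1, H.one_mem⟩, t) :=
  hT.equiv.eq_symm_apply.1 (one_mul (t : G)).symm

theorem extendTransversal_apply {B : Type*} [MulAction H B] {T : Set G}
    (hT : Subgroup.IsComplement (H : Set G) T) (y : T → B) (t : T) :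
    extendTransversal hT y t = y t := by
  have h1 : (hT.equiv (t : G)).2 = t := by rw [equiv_coe_transversal]
  have h2 : (⟨(hT.equiv (t : G)).1, (hT.equiv (t : G)).1.2⟩ : H) = 1 := by
    ext
    rw [equiv_coe_transversal]
    rfl
  rw [extendTransversal, h1, h2, one_smul]

end Coinduction

/-! ### Perturbation through approximate factors -/

namespace ActionSpace

universe u v

/-- Realization of an approximate factor on the Cantor space, with control of hitting families. -/
theorem exists_realization {G : Type u} [Group G] (ξ : ActionSpace G) {N : Set (ActionSpace G)}
    (hN : N ∈ 𝓝 ξ) {c : Set CantorSpace} (hc : IsClopen c) :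
    ∃ (F : Finset G) (n : ℕ), ∀ (M : Type v) [TopologicalSpace M] [CompactSpace M] [T2Space M]
      [TotallyDisconnectedSpace M] [SecondCountableTopology M] [MulAction G M]
      [ContinuousConstSMul G M] (_ : ∀ U : Set M, IsOpen U → U.Nonempty → U.Nontrivial)
      (p : M → CantorSpace) (_ : Continuous p) (_ : ∀ a : CantorSpace, ∃ m, ∀ i < n, p m i = a i)
      (_ : ∀ g ∈ F, ∀ m, p (g • m) = ξ g (p m)),
      ∃ φ : M ≃ₜ CantorSpace, transport (G := G) φ ∈ N ∧
        hitFamily c (transport φ) = {K : Finset G | ∃ m, ∀ k ∈ K, p (k • m) ∈ c} := by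
  obtain ⟨F, n₁, h⟩ := exists_transport_mem.{u, v} ξ hN
  obtain ⟨n₂, hn₂⟩ := exists_cylinder_of_isClopen hc
  -- `n₁` coordinates ensure closeness to `ξ`; `n₂` coordinates decide membership in `c`.
  refine ⟨F, max n₁ n₂, fun M _ _ _ _ _ _ _ hM p hp hd hF => ?_⟩
  obtain ⟨φ, hφ⟩ := exists_homeomorph_cantorSpace hM p hp _ hd
  refine ⟨φ, h M φ p (fun m i hi => hφ m i (lt_of_lt_of_le hi (le_max_left _ _))) hF, ?_⟩
  have key : ∀ m, φ m ∈ c ↔ p m ∈ c := fun m =>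
    hn₂ _ _ fun i hi => hφ m i (lt_of_lt_of_le hi (le_max_right _ _))
  ext K
  constructor
  · rintro ⟨x, hx⟩
    exact ⟨φ.symm x, fun k hk => (key _).1 (hx k hk)⟩
  · rintro ⟨m, hm⟩
    refine ⟨φ m, fun k hk => ?_⟩
    rw [transport_apply, φ.symm_apply_apply]
    exact (key _).2 (hm k hk)

end ActionSpace

/-- The points of the coinduced space which visit `c` along at most one coset. -/
def coindSparse {G : Type*} [Group G] (ξ : ActionSpace G) (H : Subgroup G) {c : Set CantorSpace}
    (hc : IsClopen c) : Shift G (ActedSpace ξ) where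
  carrier := (coind H).carrier ∩ {w | ∀ g g', w g ∈ c → w g' ∈ c → g' * g⁻¹ ∈ H}
  isClosed := by
    refine (coind H).isClosed.inter ?_
    have : {w : G → ActedSpace ξ | ∀ g g', w g ∈ c → w g' ∈ c → g' * g⁻¹ ∈ H} =
        ⋂ g, ⋂ g', {w | ¬ (w g ∈ c ∧ w g' ∈ c)} ∪ {_w | g' * g⁻¹ ∈ H} := by
      ext w
      simp only [mem_ofPred_eq, mem_iInter, mem_union]
      exact forall₂_congr fun g g' => by tauto
    rw [this]
    refine isClosed_iInter fun g => isClosed_iInter fun g' => ?_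
    have hcl : ∀ g, IsClopen {w : G → ActedSpace ξ | w g ∈ c} := fun g =>
      IsClopen.preimage (X := G → ActedSpace ξ) (Y := ActedSpace ξ) hc (continuous_apply g)
    exact ((hcl g).inter (hcl g')).compl.isClosed.union isClosed_const
  translate_mem := fun w hw γ => ⟨(coind H).translate_mem w hw.1 γ, fun g g' h1 h2 => by
    have := hw.2 _ _ h1 h2
    rwa [mul_inv_rev, mul_assoc, mul_inv_cancel_left] at this⟩

namespace ActionSpace

universe u v

/-- If some orbit avoids the clopen set `c`, then for a group which is not finitely generated the
hitting family of `c` is not locally constant. -/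
theorem exists_hitFamily_ne_of_avoids {G : Type u} [Group G] [Countable G] (hfg : ¬ Group.FG G)
    (ξ : ActionSpace G) {N : Set (ActionSpace G)} (hN : N ∈ 𝓝 ξ) {c : Set CantorSpace}
    (hc : IsClopen c) (hne : c.Nonempty) {x₀ : CantorSpace} (hx₀ : ∀ g, ξ g x₀ ∉ c) :
    ∃ η₁ ∈ N, ∃ η₂ ∈ N, hitFamily c η₁ ≠ hitFamily c η₂ := by
  classical
  obtain ⟨F, n, h⟩ := exists_realization.{u, u} ξ hN hc
  let H : Subgroup G := Subgroup.closure (F : Set G)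
  obtain ⟨k, hk⟩ : ∃ k, k ∉ H := by
    by_contra! hall
    exact hfg ⟨⟨F, (Subgroup.eq_top_iff' _).2 hall⟩⟩
  obtain ⟨T, hT, h1T⟩ := Subgroup.exists_isComplement_right H 1
  have hcoind : ∀ y : T → ActedSpace ξ,
      extendTransversal hT y ∈ (coind (A := ActedSpace ξ) H).carrier := fun y h g =>
    extendTransversal_mul hT y h g
  have hequiv : ∀ (w : G → ActedSpace ξ), w ∈ (coind (A := ActedSpace ξ) H).carrier →
      ∀ g ∈ F, w g = ξ g (w 1) := fun w hw g hg =>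
    smul_apply_one_of_mem_coind H hw ⟨g, Subgroup.subset_closure hg⟩
  -- The factor with trivial action only serves to remove isolated points.
  obtain ⟨φ₁, hφ₁, hh₁⟩ := h ((coindSparse ξ H hc).carrier × ActedSpace (1 : ActionSpace G))
    (fun _ => nontrivial_of_isOpen_prod)
    (fun m => m.1.1 1) ((continuous_apply (1 : G)).comp (continuous_subtype_val.comp continuous_fst)) (by
      intro a
      -- As the orbit of `x₀` avoids `c`, this point visits `c` only inside `H`, while its value at
      -- `1` is arbitrary.
      let y : T → ActedSpace ξ := fun t => if (t : G) = 1 then a else x₀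
      have hy1 : extendTransversal hT y 1 = a := by
        simpa [y] using extendTransversal_apply hT y ⟨1, h1T⟩
      refine ⟨(⟨extendTransversal hT y, hcoind y, ?_⟩, x₀), fun i _ => congrFun hy1 i⟩
      have key : ∀ g, extendTransversal hT y g ∈ c → g ∈ H := by
        intro g hg
        by_cases ht : ((hT.equiv g).2 : G) = 1
        · rw [← hT.equiv_fst_mul_equiv_snd g, ht, mul_one]
          exact (hT.equiv g).1.2
        · refine absurd hg ?_
          have hy : y (hT.equiv g).2 = x₀ := if_neg ht
          simp only [extendTransversal, hy]
          exact hx₀ _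
      exact fun g g' hg hg' => H.mul_mem (key _ hg') (H.inv_mem (key _ hg)))
    (fun g hg m => by
      change m.1.1 (1 * g) = _
      rw [one_mul]
      exact hequiv _ m.1.2.1 g hg)
  obtain ⟨φ₂, hφ₂, hh₂⟩ := h ((coind (A := ActedSpace ξ) H).carrier × ActedSpace (1 : ActionSpace G))
    (fun _ => nontrivial_of_isOpen_prod)
    (fun m => m.1.1 1) ((continuous_apply (1 : G)).comp (continuous_subtype_val.comp continuous_fst)) (by
      intro a
      refine ⟨(⟨extendTransversal hT fun _ => a, hcoind _⟩, x₀), fun i _ => ?_⟩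
      exact congrFun (extendTransversal_apply (B := ActedSpace ξ) hT (fun _ => a) ⟨1, h1T⟩) i)
    (fun g hg m => by
      change m.1.1 (1 * g) = _
      rw [one_mul]
      exact hequiv _ m.1.2 g hg)
  refine ⟨_, hφ₁, _, hφ₂, fun heq => ?_⟩
  rw [hh₁, hh₂] at heq
  -- `1` and `k` lie in different cosets of `H`: the full coinduced space allows visits to `c` at
  -- both, the sparse one forbids it.
  have hmem : ({1, k} : Finset G) ∈ {K : Finset G | ∃ m : (coind (A := ActedSpace ξ) H).carrier ×
      ActedSpace (1 : ActionSpace G), ∀ k ∈ K,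
      (k • m).1.1 1 ∈ c} := by
    obtain ⟨z, hz⟩ := hne
    let z' : ActedSpace ξ := z
    let t := (hT.equiv k).2
    let b : H := ⟨(hT.equiv k).1, (hT.equiv k).1.2⟩
    have hbt : (b : G) * t = k := hT.equiv_fst_mul_equiv_snd k
    have ht : (t : G) ≠ 1 := by
      intro ht
      rw [ht, mul_one] at hbt
      exact hk (hbt ▸ b.2)
    let y : T → ActedSpace ξ := fun s => if (s : G) = 1 then z' else b⁻¹ • z'
    have hy1 : extendTransversal hT y 1 = z := by
      simpa [y] using extendTransversal_apply hT y ⟨1, h1T⟩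
    have hyk : extendTransversal hT y k = z := by
      rw [← hbt, extendTransversal_mul, extendTransversal_apply]
      have hyt : y t = b⁻¹ • z' := if_neg ht
      rw [hyt, smul_inv_smul]
    refine ⟨(⟨extendTransversal hT y, hcoind y⟩, z), fun l hl => ?_⟩
    change extendTransversal hT y (1 * l) ∈ c
    rw [one_mul]
    rcases Finset.mem_insert.1 hl with rfl | hl
    · rw [hy1]; exact hz
    · rw [Finset.mem_singleton.1 hl, hyk]; exact hz
  obtain ⟨m, hm⟩ := heq.symm.subset hmem
  have h1 : m.1.1 (1 * 1) ∈ c := hm 1 (by simp)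
  have h2 : m.1.1 (1 * k) ∈ c := hm k (by simp)
  rw [one_mul] at h1 h2
  have := m.1.2.2 _ _ h1 h2
  rw [inv_one, mul_one] at this
  exact hk this

end ActionSpace

/-! ### Invariant means and orbits avoiding a clopen set -/

section Mean

variable {α : Type*} {m : Set α → NNReal}

theorem mean_empty (hadd : ∀ s t : Set α, Disjoint s t → m (s ∪ t) = m s + m t) : m ∅ = 0 := by
  have := hadd ∅ ∅ (disjoint_empty _)
  rw [union_empty] at this
  simpa using this

theorem mean_mono (hadd : ∀ s t : Set α, Disjoint s t → m (s ∪ t) = m s + m t) {s t : Set α}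
    (hst : s ⊆ t) : m s ≤ m t := by
  rw [← union_sdiff_cancel hst, hadd _ _ disjoint_sdiff_right]
  exact le_self_add

theorem mean_union_le (hadd : ∀ s t : Set α, Disjoint s t → m (s ∪ t) = m s + m t) (s t : Set α) :
    m (s ∪ t) ≤ m s + m t := by
  rw [← union_sdiff_self, hadd _ _ disjoint_sdiff_right]
  gcongr
  exact mean_mono hadd sdiff_subset

theorem mean_biUnion_le (hadd : ∀ s t : Set α, Disjoint s t → m (s ∪ t) = m s + m t)
    {ι : Type*} (I : Finset ι) (B : ι → Set α) : m (⋃ i ∈ I, B i) ≤ ∑ i ∈ I, m (B i) := by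
  classical
  induction I using Finset.induction_on with
  | empty => simp [mean_empty hadd]
  | insert a I ha ih =>
    rw [Finset.set_biUnion_insert, Finset.sum_insert ha]
    exact (mean_union_le hadd _ _).trans (by gcongr)

theorem mean_biUnion (hadd : ∀ s t : Set α, Disjoint s t → m (s ∪ t) = m s + m t)
    {ι : Type*} (I : Finset ι) (B : ι → Set α)
    (hB : ∀ i ∈ I, ∀ j ∈ I, i ≠ j → Disjoint (B i) (B j)) :
    m (⋃ i ∈ I, B i) = ∑ i ∈ I, m (B i) := by
  classical
  induction I using Finset.induction_on with
  | empty => simp [mean_empty hadd]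
  | insert a I ha ih =>
    rw [Finset.set_biUnion_insert, Finset.sum_insert ha, hadd, ih]
    · exact fun i hi j hj => hB i (Finset.mem_insert_of_mem hi) j (Finset.mem_insert_of_mem hj)
    · refine disjoint_iUnion₂_right.2 fun i hi => ?_
      exact hB a (Finset.mem_insert_self _ _) i (Finset.mem_insert_of_mem hi) fun h => ha (h ▸ hi)

end Mean

/-- If the Cantor space is compressed off `c` by a piecewise translation, then some orbit of an
action of an amenable group avoids `c`. -/
theorem exists_orbit_avoids {G : Type*} [Group G] (hamen : IsAmenableGroup G)
    (ξ : ActionSpace G) {c : Set CantorSpace}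
    (hc : IsClopen c) (S : Finset G) (V : G → Set CantorSpace) (hV : ∀ x, ∃ s ∈ S, x ∈ V s)
    (hdisj : ∀ x, ∀ s ∈ S, ∀ t ∈ S, ξ s⁻¹ x ∈ V s → ξ t⁻¹ x ∈ V t → s = t)
    (hcV : ∀ x ∈ c, ∀ s ∈ S, ξ s⁻¹ x ∉ V s) : ∃ x, ∀ g, ξ g x ∉ c := by
  obtain ⟨m, h1, hadd, hinv⟩ := hamen
  have hmul : ∀ g h x, ξ (g * h) x = ξ g (ξ h x) := fun g h x => by rw [map_mul]; rfl
  have himg : ∀ (g : G) (B : Set CantorSpace) (x : CantorSpace),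
      m {h | ξ (g * h) x ∈ B} = m {h | ξ h x ∈ B} := by
    intro g B x
    rw [← hinv g⁻¹ {h | ξ h x ∈ B}]
    congr 1
    ext h
    constructor
    · intro hh
      exact ⟨g * h, hh, inv_mul_cancel_left _ _⟩
    · rintro ⟨k, hk, rfl⟩
      simpa using hk
  -- By invariance the sets of `h` with `ξ (s⁻¹ * h) x ∈ V s` have total mass at least `1`; being
  -- disjoint from each other and from the visits to `c`, they leave no mass for the latter.
  have hnull : ∀ x, m {h | ξ h x ∈ c} = 0 := by
    intro x
    have hle : 1 ≤ ∑ s ∈ S, m {h | ξ (s⁻¹ * h) x ∈ V s} := by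
      simp only [himg]
      rw [← h1]
      refine le_trans (mean_mono hadd ?_) (mean_biUnion_le hadd S fun s => {h | ξ h x ∈ V s})
      intro h _
      obtain ⟨s, hs, hx⟩ := hV (ξ h x)
      exact mem_biUnion hs hx
    rw [← mean_biUnion hadd S] at hle
    · have hd : Disjoint {h | ξ h x ∈ c} (⋃ s ∈ S, {h | ξ (s⁻¹ * h) x ∈ V s}) := by
        refine disjoint_iUnion₂_right.2 fun s hs => disjoint_left.2 fun h hh hh' => ?_
        exact hcV _ hh s hs (by rw [← hmul]; exact hh')
      have h2 : m {h | ξ h x ∈ c} + 1 ≤ 0 + 1 := by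
        calc m {h | ξ h x ∈ c} + 1 ≤ _ := add_le_add le_rfl hle
          _ = _ := (hadd _ _ hd).symm
          _ ≤ m univ := mean_mono hadd (subset_univ _)
          _ = 0 + 1 := by rw [h1, zero_add]
      exact le_antisymm (le_of_add_le_add_right h2) zero_le
    · intro s hs t ht hst
      refine disjoint_left.2 fun h hh hh' => hst (hdisj (ξ h x) s hs t ht ?_ ?_)
      · rw [← hmul]; exact hh
      · rw [← hmul]; exact hh'
  -- If every orbit met `c`, finitely many translates of the null set of visits would cover `G`.
  by_contra! hcon
  obtain ⟨F, hF⟩ := isCompact_univ.elim_finite_subcover (fun g : G => ξ g ⁻¹' c)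
    (fun g => hc.isOpen.preimage (ξ g).continuous) (fun x _ => mem_iUnion.2 (hcon x))
  have x : CantorSpace := fun _ => true
  have : m univ ≤ 0 := by
    calc m univ ≤ m (⋃ g ∈ F, {h | ξ (g * h) x ∈ c}) := by
          refine mean_mono hadd fun h _ => ?_
          obtain ⟨g, hg, hx⟩ := mem_iUnion₂.1 (hF (mem_univ (ξ h x)))
          refine mem_iUnion₂.2 ⟨g, hg, ?_⟩
          change ξ (g * h) x ∈ c
          rw [hmul]
          exact hx
      _ ≤ ∑ g ∈ F, m {h | ξ (g * h) x ∈ c} := mean_biUnion_le hadd F _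
      _ = 0 := Finset.sum_eq_zero fun g _ => by rw [himg, hnull]
  rw [h1] at this
  exact absurd this (by simp)

/-! ### Piecewise translations and compressing actions -/

open scoped Pointwise in
/-- A finite set generating an infinite subgroup admits a non-surjective injective piecewise
translation. -/
theorem exists_injective_translation {G : Type*} [Group G] {S : Finset G} (h1 : (1 : G) ∈ S)
    (hS : Infinite (Subgroup.closure (S : Set G))) :
    ∃ τ : G → G, Function.Injective τ ∧ ∀ g, τ g * g⁻¹ ∈ S ∧ τ g ≠ 1 := by
  classical
  obtain ⟨τ, hτ, hτ'⟩ := (Finset.all_card_le_biUnion_card_iff_exists_injective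
    fun g : G => (S.image fun s => s * g).erase 1).1 (by
      intro A
      rcases A.eq_empty_or_nonempty with rfl | ⟨a, ha⟩
      · simp
      have hsub : A ⊆ S * A := fun x hx => Finset.mem_mul.2 ⟨1, h1, x, hx, one_mul x⟩
      -- Equality would make the infinite group `⟨S⟩` stabilize `A` and embed in it. The strict
      -- growth pays for the erased `1` in Hall's condition.
      have hlt : A.card < (S * A).card := by
        by_contra hle
        have heq : A = S * A := Finset.eq_of_subset_of_card_le hsub (not_lt.1 hle)
        have hstab : Subgroup.closure (S : Set G) ≤ MulAction.stabilizer G A := by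
          rw [Subgroup.closure_le]
          intro s hs
          refine Finset.eq_of_subset_of_card_le ?_ (Finset.card_smul_finset s A).ge
          intro x hx
          obtain ⟨y, hy, rfl⟩ := Finset.mem_smul_finset.1 hx
          rw [heq]
          exact Finset.mul_mem_mul hs hy
        have hmem : ∀ h : Subgroup.closure (S : Set G), (h : G) * a ∈ A := fun h => by
          have h2 : (h : G) • A = A := hstab h.2
          have h3 := Finset.smul_mem_smul_finset (a := (h : G)) ha
          rwa [h2] at h3
        exact not_injective_infinite_finite
          (fun h : Subgroup.closure (S : Set G) => (⟨(h : G) * a, hmem h⟩ : A))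
          fun h h' hh => Subtype.ext (mul_right_cancel (congrArg Subtype.val hh))
      have hbi : (S * A).erase 1 ⊆ A.biUnion fun g => (S.image fun s => s * g).erase 1 := by
        intro x hx
        obtain ⟨hx1, hx⟩ := Finset.mem_erase.1 hx
        obtain ⟨s, hs, y, hy, rfl⟩ := Finset.mem_mul.1 hx
        exact Finset.mem_biUnion.2 ⟨y, hy, Finset.mem_erase.2
          ⟨hx1, Finset.mem_image_of_mem _ hs⟩⟩
      have := Finset.card_le_card hbi
      have := Finset.pred_card_le_card_erase (s := S * A) (a := 1)
      omega)
  refine ⟨τ, hτ, fun g => ?_⟩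
  obtain ⟨hne, hmem⟩ := Finset.mem_erase.1 (hτ' g)
  obtain ⟨s, hs, hsg⟩ := Finset.mem_image.1 hmem
  exact ⟨by rw [← hsg, mul_inv_cancel_right]; exact hs, hne⟩

/-- The shift of all injective piecewise translations with displacements in `S`. -/
def translationShift {G : Type*} [Group G] (S : Finset G) [TopologicalSpace S]
    [DiscreteTopology S] : Shift G S where
  carrier := {σ | Function.Injective fun g => (σ g : G) * g}
  isClosed := by
    have : {σ : G → S | Function.Injective fun g => (σ g : G) * g} =
        ⋂ g, ⋂ h, {σ | (σ g : G) * g = σ h * h → g = h} := by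
      ext σ
      simp only [mem_iInter]
      exact Iff.rfl
    rw [this]
    refine isClosed_iInter fun g => isClosed_iInter fun h => ?_
    have hcont : Continuous fun σ : G → S => (σ g, σ h) := by fun_prop
    exact (isClosed_discrete {q : S × S | (q.1 : G) * g = q.2 * h → g = h}).preimage hcont
  translate_mem σ hσ γ g h hgh := by
    refine mul_right_cancel (hσ (a₁ := g * γ) (a₂ := h * γ) ?_)
    change (σ (g * γ) : G) * (g * γ) = σ (h * γ) * (h * γ)
    rw [← mul_assoc, ← mul_assoc]
    exact congrArg (· * γ) hgh

namespace ActionSpace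

/-- A group which is not locally finite has an action for which the Cantor space is compressed off
some clopen set by a piecewise translation. -/
theorem exists_compressing_action {G : Type*} [Group G] [Countable G]
    (hlf : ¬ IsLocallyFiniteGroup G) : ∃ (ξ : ActionSpace G) (c : Set CantorSpace) (S : Finset G)
      (V : G → Set CantorSpace), IsClopen c ∧ c.Nonempty ∧ (∀ s, IsClopen (V s)) ∧
      (∀ x, ∃ s ∈ S, x ∈ V s) ∧
      (∀ x, ∀ s ∈ S, ∀ t ∈ S, ξ s⁻¹ x ∈ V s → ξ t⁻¹ x ∈ V t → s = t) ∧
      ∀ x ∈ c, ∀ s ∈ S, ξ s⁻¹ x ∉ V s := by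
  classical
  obtain ⟨H, ⟨S₀, rfl⟩, hH⟩ : ∃ H : Subgroup G, H.FG ∧ ¬ Finite H := by
    simpa [IsLocallyFiniteGroup] using hlf
  let S : Finset G := insert 1 S₀
  have h1 : (1 : G) ∈ S := Finset.mem_insert_self _ _
  have hS : Infinite (Subgroup.closure (S : Set G)) := by
    have hle : Subgroup.closure (S₀ : Set G) ≤ Subgroup.closure (S : Set G) :=
      Subgroup.closure_mono (Finset.coe_subset.2 (Finset.subset_insert _ _))
    have := not_finite_iff_infinite.1 hH
    exact Infinite.of_injective _ (Subgroup.inclusion_injective hle)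
  obtain ⟨τ, hτ, hτS⟩ := exists_injective_translation h1 hS
  let _ : TopologicalSpace S := ⊥
  have : DiscreteTopology S := ⟨rfl⟩
  let M := (translationShift S).carrier × ActedSpace (1 : ActionSpace G)
  have hcoord : ∀ g : G, Continuous fun q : M => q.1.1 g := fun g =>
    (continuous_apply g).comp (continuous_subtype_val.comp continuous_fst)
  let x₀ : ActedSpace (1 : ActionSpace G) := (fun _ => true : CantorSpace)
  let q₀ : M := (⟨fun g => ⟨τ g * g⁻¹, (hτS g).1⟩, fun g h hgh => hτ (by simpa using hgh)⟩, x₀)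
  obtain ⟨φ, -⟩ := exists_homeomorph_cantorSpace (M := M) (fun _ => nontrivial_of_isOpen_prod)
    (fun _ => x₀) continuous_const 0 (fun _ => ⟨q₀, fun i hi => absurd hi (Nat.not_lt_zero i)⟩)
  -- Since `σ(s⁻¹) = s` says that the translation `g ↦ σ(g)g` sends `s⁻¹` to `1`, `c₀` consists of
  -- the translations missing `1`, and injectivity permits at most one such `s`.
  let c₀ : Set M := {q | ∀ s : S, q.1.1 (s : G)⁻¹ ≠ s}
  let V₀ : G → Set M := fun s => {q | (q.1.1 1 : G) = s}
  have hc₀ : IsClopen c₀ := by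
    have : c₀ = ⋂ s : S, {q | q.1.1 (s : G)⁻¹ ≠ s} := by
      ext q
      simp [c₀]
    rw [this]
    exact isClopen_iInter_of_finite fun s =>
      (isClopen_discrete {s}).compl.preimage (hcoord (s : G)⁻¹)
  have hmem : ∀ (s : G) (q : M), s ∈ S → (s⁻¹ • q ∈ V₀ s ↔ (q.1.1 s⁻¹ : G) = s) := by
    intro s q _
    change (q.1.1 (1 * s⁻¹) : G) = s ↔ _
    rw [one_mul]
  refine ⟨transport φ, φ.symm ⁻¹' c₀, S, fun s => φ.symm ⁻¹' V₀ s, hc₀.preimage φ.symm.continuous,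
    ⟨φ q₀, ?_⟩, fun s => ?_, fun x => ⟨((φ.symm x).1.1 1 : G), ((φ.symm x).1.1 1).2, rfl⟩, ?_, ?_⟩
  · change φ.symm (φ q₀) ∈ c₀
    rw [φ.symm_apply_apply]
    intro s hs
    refine (hτS (s : G)⁻¹).2 ?_
    have h3 : τ (s : G)⁻¹ * ((s : G)⁻¹)⁻¹ = s := congrArg Subtype.val hs
    simpa using h3
  · exact ((isClopen_discrete {t : S | (t : G) = s}).preimage (hcoord 1)).preimage
      φ.symm.continuous
  · intro x s hs t ht hxs hxt
    simp only [mem_preimage, transport_apply, φ.symm_apply_apply] at hxs hxt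
    rw [hmem s _ hs] at hxs
    rw [hmem t _ ht] at hxt
    refine inv_injective ((φ.symm x).1.2 ?_)
    change ((φ.symm x).1.1 s⁻¹ : G) * s⁻¹ = ((φ.symm x).1.1 t⁻¹ : G) * t⁻¹
    rw [hxs, hxt, mul_inv_cancel, mul_inv_cancel]
  · intro x hx s hs hxs
    simp only [mem_preimage, transport_apply, φ.symm_apply_apply] at hxs
    rw [hmem s _ hs] at hxs
    exact hx ⟨s, hs⟩ (Subtype.ext hxs)

/-- Compression involves finitely many clopen conditions, so it holds near `ζ`; every action there
has an orbit avoiding `c`, and its hitting family can be changed. -/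
theorem conjClass_not_residual_of_not_locallyFinite {G : Type*} [Group G] [Countable G]
    (hamen : IsAmenableGroup G) (hfg : ¬ Group.FG G) (hlf : ¬ IsLocallyFiniteGroup G)
    (ξ : ActionSpace G) : conjClass ξ ∉ residual (ActionSpace G) := by
  intro hξ
  obtain ⟨ζ, c, S, V, hc, hne, hV, hcov, hdisj, hcV⟩ := exists_compressing_action hlf
  have hev : ∀ᶠ η in 𝓝 ζ, ∀ s ∈ S, ∀ x, η s⁻¹ x ∈ V s ↔ ζ s⁻¹ x ∈ V s :=
    (Finset.eventually_all S).2 fun s _ => eventually_mem_iff ζ s⁻¹ (hV s)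
  obtain ⟨N, hNsub, hN, hζN⟩ := mem_nhds_iff.1 hev
  obtain ⟨N', hN'N, hN', ⟨η, hη⟩, hconst⟩ :=
    exists_open_hitFamily_const continuous_id hξ hc hN ⟨ζ, hζN⟩
  have hηS : ∀ s ∈ S, ∀ x, η s⁻¹ x ∈ V s ↔ ζ s⁻¹ x ∈ V s := hNsub (hN'N hη)
  obtain ⟨x₀, hx₀⟩ := exists_orbit_avoids hamen η hc S V hcov
    (fun x s hs t ht h h' => hdisj x s hs t ht ((hηS s hs x).1 h) ((hηS t ht x).1 h'))
    (fun x hx s hs h => hcV x hx s hs ((hηS s hs x).1 h))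
  obtain ⟨η₁, h₁, η₂, h₂, hne'⟩ :=
    exists_hitFamily_ne_of_avoids hfg η (hN'.mem_nhds hη) hc hne hx₀
  exact hne' (hconst η₁ h₁ η₂ h₂)

end ActionSpace

/-! ### Counting equivariant maps on finite groups -/

/-- A union bound: some function agrees somewhere with each member of a family of functions. -/
theorem exists_fun_agreeing {X T H : Type*} [Finite X] [Finite T] [Finite H] (a : X → T → H)
    (h : Nat.card X * (Nat.card H - 1) ^ Nat.card T < Nat.card H ^ Nat.card T) :
    ∃ σ : T → H, ∀ x, ∃ t, σ t = a x t := by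
  classical
  have := Fintype.ofFinite X
  have := Fintype.ofFinite T
  have := Fintype.ofFinite H
  simp only [Nat.card_eq_fintype_card] at h
  by_contra! hcon
  have hsub : (Finset.univ : Finset (T → H)) ⊆
      Finset.univ.biUnion fun x => Fintype.piFinset fun t => Finset.univ.erase (a x t) := by
    intro σ _
    obtain ⟨x, hx⟩ := hcon σ
    exact Finset.mem_biUnion.2 ⟨x, Finset.mem_univ _, Fintype.mem_piFinset.2 fun t =>
      Finset.mem_erase.2 ⟨hx t, Finset.mem_univ _⟩⟩
  have hle := (Finset.card_le_card hsub).trans Finset.card_biUnion_le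
  simp only [Fintype.card_piFinset, Finset.card_univ, Finset.card_erase_of_mem (Finset.mem_univ _),
    Finset.prod_const, Finset.sum_const, Fintype.card_fun, smul_eq_mul] at hle
  omega

/-- Exponential decay of `((m - 1) / m) ^ n` beats `n`. It is used with `m = |H|` and `n` the index,
so that `m * n` is the order of the larger group. -/
theorem exists_nat_mul_pow_lt (m : ℕ) (hm : 0 < m) :
    ∃ n₀, ∀ n ≥ n₀, m * n * (m - 1) ^ n < m ^ n := by
  have hm' : (0 : ℝ) < m := by exact_mod_cast hm
  have h1 : ((m - 1 : ℕ) : ℝ) / m < 1 := by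
    rw [div_lt_one hm']
    exact_mod_cast Nat.sub_lt hm one_pos
  have h2 := tendsto_self_mul_const_pow_of_lt_one (by positivity) h1
  obtain ⟨n₀, hn₀⟩ := eventually_atTop.1 (h2.eventually_lt_const (show (0 : ℝ) < 1 / m by positivity))
  refine ⟨n₀, fun n hn => ?_⟩
  have h3 := hn₀ n hn
  rw [div_pow, ← mul_div_assoc, div_lt_div_iff₀ (by positivity) hm', one_mul] at h3
  have h4 : (m : ℝ) * n * ((m - 1 : ℕ) : ℝ) ^ n < (m : ℝ) ^ n := by linarith
  exact_mod_cast h4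

/-- Two equivariant maps on a finite group with prescribed values in their ranges: one of them maps
some set `K` into `c`, while the other maps no translate of `K` into `c`. -/
theorem exists_equivariant_pair {Γ B ι : Type*} [Group Γ] [Finite Γ] (H : Subgroup Γ)
    [MulAction H B] [Nonempty B] [Finite ι] (b : ι → B) (c : Set B) (hc : ∀ y, ∃ h : H, h • y ∈ c)
    (hc' : ∀ y, ∃ h : H, h • y ∉ c) (hι : Nat.card ι ≤ H.index)
    (hcard : Nat.card Γ * (Nat.card H - 1) ^ H.index < Nat.card H ^ H.index) :
    ∃ (K : Finset Γ) (z₁ z₂ : Γ → B),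
      (∀ (h : H) x, z₁ (h * x) = h • z₁ x) ∧ (∀ (h : H) x, z₂ (h * x) = h • z₂ x) ∧
      (∀ i, ∃ x, z₁ x = b i) ∧ (∀ i, ∃ x, z₂ x = b i) ∧
      (∀ x, ∃ k ∈ K, z₁ (k * x) ∉ c) ∧ ∀ k ∈ K, z₂ k ∈ c := by
  classical
  obtain ⟨T, hT, -⟩ := H.exists_isComplement_right 1
  have hTcard : Nat.card T = H.index := hT.card_right
  have hTfin : T.Finite := toFinite T
  obtain ⟨e⟩ : Nonempty (ι ↪ T) := by
    have := Fintype.ofFinite ι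
    have := Fintype.ofFinite T
    refine Function.Embedding.nonempty_of_card_le ?_
    rw [← Nat.card_eq_fintype_card, ← Nat.card_eq_fintype_card, hTcard]
    exact hι
  let y : T → B := Function.extend e b fun _ => Classical.arbitrary B
  have hy : ∀ i, y (e i) = b i := fun i => e.injective.extend_apply _ _ _
  -- Right translation by `x` permutes the cosets through `π x`, with cocycle `α x` in `H`.
  let π : Γ → T → T := fun x t => (hT.equiv (t * x)).2
  let α : Γ → T → H := fun x t => ⟨(hT.equiv (t * x)).1, (hT.equiv (t * x)).1.2⟩
  have hαπ : ∀ x t, (α x t : Γ) * π x t = t * x := fun x t => hT.equiv_fst_mul_equiv_snd _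
  have hπ : ∀ x, Function.Bijective (π x) := by
    intro x
    refine Finite.injective_iff_bijective.1 fun t t' htt => ?_
    have h1 : (t : Γ) = ((α x t * (α x t')⁻¹ : H) : Γ) * t' := by
      have h2 := hαπ x t
      have h3 := hαπ x t'
      rw [← htt] at h3
      have h4 : (π x t : Γ) = (α x t' : Γ)⁻¹ * (t' * x) := by rw [← h3, inv_mul_cancel_left]
      rw [h4, ← mul_assoc, ← mul_assoc] at h2
      simpa using (mul_right_cancel h2).symm
    have h5 := congrArg Prod.snd (equiv_coe_transversal hT t)
    rw [h1, hT.equiv_mul_left, equiv_coe_transversal] at h5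
    exact h5.symm
  -- For each `x`, some `s` satisfies `σ (π x s) = α x s`. The twist by `σ⁻¹` in `z₁` then cancels
  -- the cocycle, leaving `z₁ (s * x)` outside `c`.
  obtain ⟨σ, hσ⟩ := exists_fun_agreeing
    (fun (x : Γ) (t : T) => α x ((Equiv.ofBijective _ (hπ x)).symm t)) (by rwa [hTcard])
  choose h hh using hc
  choose h' hh' using hc'
  refine ⟨hTfin.toFinset, extendTransversal hT fun t => (σ t)⁻¹ • h' (y t) • y t,
    extendTransversal hT fun t => h (y t) • y t, extendTransversal_mul hT _,
    extendTransversal_mul hT _, fun i => ?_, fun i => ?_, fun x => ?_, fun k hk => ?_⟩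
  · refine ⟨((h' (y (e i)))⁻¹ * σ (e i) : H) * e i, ?_⟩
    rw [extendTransversal_mul, extendTransversal_apply, mul_smul, smul_inv_smul, inv_smul_smul, hy]
  · refine ⟨((h (y (e i)))⁻¹ : H) * e i, ?_⟩
    rw [extendTransversal_mul, extendTransversal_apply, inv_smul_smul, hy]
  · obtain ⟨t, ht⟩ := hσ x
    set s := (Equiv.ofBijective _ (hπ x)).symm t with hs
    have hst : π x s = t := (Equiv.ofBijective _ (hπ x)).apply_symm_apply t
    refine ⟨s, hTfin.mem_toFinset.2 s.2, ?_⟩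
    rw [← hαπ, ← ht, hst, extendTransversal_mul, extendTransversal_apply, smul_inv_smul]
    exact hh' _
  · have := extendTransversal_apply hT (fun t => h (y t) • y t) ⟨k, hTfin.mem_toFinset.1 hk⟩
    dsimp only at this
    rw [this]
    exact hh _

/-! ### Perturbation over locally finite groups -/

namespace ActionSpace

universe u v

/-- For an infinite locally finite group, any Cantor system with an equivariant map to a suitable
finite subgroup is conjugate to two actions close to `ξ` with different hitting families of `c`. -/
theorem exists_finite_subgroup_realizations {G : Type u} [Group G] [Infinite G]
    (hlf : IsLocallyFiniteGroup G) (ξ : ActionSpace G) {N : Set (ActionSpace G)} (hN : N ∈ 𝓝 ξ)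
    {c : Set CantorSpace} (hc : IsClopen c) {F₀ : Finset G} (hF₀ : ∀ x, ∃ g ∈ F₀, ξ g x ∈ c)
    (hF₀' : ∀ x, ∃ g ∈ F₀, ξ g x ∉ c) :
    ∃ Γ : Subgroup G, Finite Γ ∧ ∀ (M : Type v) [TopologicalSpace M] [CompactSpace M] [T2Space M]
      [TotallyDisconnectedSpace M] [SecondCountableTopology M] [MulAction G M]
      [ContinuousConstSMul G M] [Nonempty M]
      (_ : ∀ U : Set M, IsOpen U → U.Nonempty → U.Nontrivial)
      (u : M → Γ) (_ : IsLocallyConstant u) (_ : ∀ (γ : Γ) m, u ((γ : G) • m) = γ * u m),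
      ∃ φ₁ φ₂ : M ≃ₜ CantorSpace, transport (G := G) φ₁ ∈ N ∧ transport (G := G) φ₂ ∈ N ∧
        hitFamily c (transport (G := G) φ₁) ≠ hitFamily c (transport (G := G) φ₂) := by
  classical
  obtain ⟨F, n, hreal⟩ := exists_realization.{u, v} ξ hN hc
  let H : Subgroup G := Subgroup.closure ((F ∪ F₀ : Finset G) : Set G)
  have hHfin : Finite H := hlf H ⟨_, rfl⟩
  have hFH : ∀ g ∈ F, g ∈ H := fun g hg => Subgroup.subset_closure (by simp [hg])
  have hF₀H : ∀ g ∈ F₀, g ∈ H := fun g hg => Subgroup.subset_closure (by simp [hg])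
  obtain ⟨n₀, hn₀⟩ := exists_nat_mul_pow_lt (Nat.card H) Nat.card_pos
  -- This size forces index at least `n₀`, for the counting, and at least `2 ^ n`, to give each
  -- cylinder of length `n` its own coset.
  obtain ⟨E, hE⟩ := Infinite.exists_subset_card_eq G (Nat.card H * max n₀ (2 ^ n))
  let Γ : Subgroup G := Subgroup.closure ((F ∪ F₀ ∪ E : Finset G) : Set G)
  have hΓfin : Finite Γ := hlf Γ ⟨_, rfl⟩
  have hHΓ : H ≤ Γ := Subgroup.closure_mono (Finset.coe_subset.2 Finset.subset_union_left)
  let Λ : Subgroup Γ := H.subgroupOf Γ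
  let j : Λ ≃* H := Subgroup.subgroupOfEquivOfLe hHΓ
  have hj : ∀ h : Λ, (j h : G) = ((h : Γ) : G) := fun _ => rfl
  have hΛcard : Nat.card Λ = Nat.card H := Nat.card_congr j.toEquiv
  have hΓcard : Nat.card H * Λ.index = Nat.card Γ := by rw [← hΛcard, Λ.card_mul_index]
  have hindex : max n₀ (2 ^ n) ≤ Λ.index := by
    have hEΓ : Nat.card H * max n₀ (2 ^ n) ≤ Nat.card Γ := by
      rw [← hE, ← Fintype.card_coe, ← Nat.card_eq_fintype_card]
      exact Nat.card_le_card_of_injective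
        (fun e : E => (⟨e, Subgroup.subset_closure (by simp)⟩ : Γ))
        fun e e' h => Subtype.ext (congrArg (fun g : Γ => (g : G)) h)
    rw [← hΓcard] at hEΓ
    exact Nat.le_of_mul_le_mul_left hEΓ Nat.card_pos
  let _ : MulAction Λ CantorSpace := MulAction.compHom (ActedSpace ξ) j.toMonoidHom
  have hsmul : ∀ (h : Λ) (x : CantorSpace), h • x = ξ ((h : Γ) : G) x := fun _ _ => rfl
  have hlift : ∀ g ∈ F ∪ F₀, ∃ h : Λ, ((h : Γ) : G) = g := fun g hg =>
    have hgH : g ∈ H := Subgroup.subset_closure hg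
    ⟨⟨⟨g, hHΓ hgH⟩, hgH⟩, rfl⟩
  let b : (Fin n → Bool) → CantorSpace := fun a i => if h : i < n then a ⟨i, h⟩ else true
  obtain ⟨K, z₁, z₂, hz₁, hz₂, hb₁, hb₂, hK₁, hK₂⟩ := exists_equivariant_pair Λ b c
    (fun y => by
      obtain ⟨g, hg, hy⟩ := hF₀ y
      obtain ⟨h, rfl⟩ := hlift g (Finset.mem_union_right _ hg)
      exact ⟨h, hy⟩)
    (fun y => by
      obtain ⟨g, hg, hy⟩ := hF₀' y
      obtain ⟨h, rfl⟩ := hlift g (Finset.mem_union_right _ hg)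
      exact ⟨h, hy⟩)
    (by
      rw [Nat.card_eq_fintype_card, Fintype.card_fun, Fintype.card_bool, Fintype.card_fin]
      exact (le_max_right _ _).trans hindex)
    (by
      rw [← hΓcard, hΛcard]
      exact hn₀ _ ((le_max_left _ _).trans hindex))
  refine ⟨Γ, hΓfin, fun M _ _ _ _ _ _ _ _ hM u hu hueq => ?_⟩
  have husurj : Function.Surjective u := by
    intro γ
    obtain ⟨m⟩ := ‹Nonempty M›
    exact ⟨((γ * (u m)⁻¹ : Γ) : G) • m, by rw [hueq, inv_mul_cancel_right]⟩
  have hkey : ∀ z : Γ → CantorSpace, (∀ (h : Λ) x, z (h * x) = h • z x) → (∀ a, ∃ x, z x = b a) →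
      ∃ φ : M ≃ₜ CantorSpace, transport (G := G) φ ∈ N ∧
        hitFamily c (transport (G := G) φ) = {K : Finset G | ∃ m : M, ∀ k ∈ K, z (u (k • m)) ∈ c} := by
    intro z hz hbz
    refine hreal M hM (fun m => z (u m)) (hu.comp z).continuous (fun a => ?_) fun g hg m => ?_
    · obtain ⟨x, hx⟩ := hbz fun i => a i
      obtain ⟨m, rfl⟩ := husurj x
      refine ⟨m, fun i hi => ?_⟩
      rw [hx]
      simp [b, hi]
    · obtain ⟨h, rfl⟩ := hlift g (Finset.mem_union_left _ hg)
      rw [hueq, hz, hsmul]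
  obtain ⟨φ₁, hφ₁, hh₁⟩ := hkey z₁ hz₁ hb₁
  obtain ⟨φ₂, hφ₂, hh₂⟩ := hkey z₂ hz₂ hb₂
  refine ⟨φ₁, φ₂, hφ₁, hφ₂, fun heq => ?_⟩
  rw [hh₁, hh₂] at heq
  have hmem : (K.image fun k : Γ => (k : G)) ∈
      {K : Finset G | ∃ m : M, ∀ k ∈ K, z₂ (u (k • m)) ∈ c} := by
    obtain ⟨m, hm⟩ := husurj 1
    refine ⟨m, fun k hk => ?_⟩
    obtain ⟨l, hl, rfl⟩ := Finset.mem_image.1 hk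
    rw [hueq, hm, mul_one]
    exact hK₂ l hl
  rw [← heq] at hmem
  obtain ⟨m, hm⟩ := hmem
  obtain ⟨k, hk, hkx⟩ := hK₁ (u m)
  refine hkx ?_
  rw [← hueq]
  exact hm k (Finset.mem_image_of_mem _ hk)

end ActionSpace

/-! ### Minimal systems -/

/-- A nonempty compact `G`-space contains a minimal closed invariant set. -/
theorem exists_isMinimal_subMulAction {G X : Type*} [Group G] [TopologicalSpace X] [CompactSpace X]
    [Nonempty X] [MulAction G X] [ContinuousConstSMul G X] :
    ∃ Z : SubMulAction G X, IsClosed (Z : Set X) ∧ (Z : Set X).Nonempty ∧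
      MulAction.IsMinimal G Z := by
  let P : Set (Set X) := {s | IsClosed s ∧ s.Nonempty ∧ ∀ (g : G), ∀ x ∈ s, g • x ∈ s}
  obtain ⟨s, -, hs⟩ := zorn_superset_nonempty P (by
    intro C hCP hC hCne
    refine ⟨⋂₀ C, ⟨isClosed_sInter fun s hs => (hCP hs).1, ?_, fun g x hx => ?_⟩,
      fun s hs => sInter_subset_of_mem hs⟩
    · have := hCne.to_subtype
      refine IsCompact.nonempty_sInter_of_directed_nonempty_isCompact_isClosed ?_
        (fun s hs => (hCP hs).2.1) (fun s hs => (hCP hs).1.isCompact) fun s hs => (hCP hs).1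
      intro s hs t ht
      rcases hC.total hs ht with h | h
      · exact ⟨s, hs, Subset.rfl, h⟩
      · exact ⟨t, ht, h, Subset.rfl⟩
    · exact mem_sInter.2 fun s hs => (hCP hs).2.2 g x (mem_sInter.1 hx s hs))
    univ ⟨isClosed_univ, univ_nonempty, fun _ _ _ => trivial⟩
  let Z : SubMulAction G X := ⟨s, fun g x hx => hs.prop.2.2 g x hx⟩
  refine ⟨Z, hs.prop.1, hs.prop.2.1, ⟨fun x => ?_⟩⟩
  have hcl : IsClosed (Subtype.val '' closure (MulAction.orbit G x) : Set X) :=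
    hs.prop.1.isClosedEmbedding_subtypeVal.isClosedMap _ isClosed_closure
  have hinv : ∀ g : G, ∀ y ∈ closure (MulAction.orbit G x), g • y ∈ closure (MulAction.orbit G x) := by
    intro g y hy
    have hcont : Continuous fun z : Z => g • z :=
      Continuous.subtype_mk (continuous_subtype_val.const_smul g) _
    refine map_mem_closure hcont hy ?_
    rintro z ⟨h, rfl⟩
    exact ⟨g * h, mul_smul g h x⟩
  have hle : (Subtype.val '' closure (MulAction.orbit G x) : Set X) ⊆ s := by
    rintro _ ⟨y, -, rfl⟩
    exact y.2
  have heq := hs.le_of_le (y := Subtype.val '' closure (MulAction.orbit G x))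
    ⟨hcl, ⟨x, x, subset_closure (MulAction.mem_orbit_self x), rfl⟩, by
      rintro g _ ⟨y, hy, rfl⟩
      exact ⟨g • y, hinv g y hy, rfl⟩⟩ hle
  intro y
  obtain ⟨y', hy', hyy⟩ := heq y.2
  rwa [Subtype.ext hyy] at hy'

open scoped Pointwise in
/-- An infinite compact minimal `G`-space has no isolated points. -/
theorem nontrivial_of_isOpen_of_isMinimal {G X : Type*} [Group G] [TopologicalSpace X]
    [CompactSpace X] [Infinite X] [MulAction G X] [ContinuousConstSMul G X]
    [MulAction.IsMinimal G X] {U : Set X} (hU : IsOpen U) (hne : U.Nonempty) : U.Nontrivial := by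
  by_contra hnt
  rw [not_nontrivial_iff] at hnt
  obtain ⟨I, hI⟩ := isCompact_univ.exists_finite_cover_smul G hU hne
  have : (⋃ g ∈ I, g • U).Finite := I.finite_toSet.biUnion fun g _ => hnt.finite.image _
  exact infinite_univ (this.subset hI)

namespace ActionSpace

theorem isMinimal_transport {G M : Type*} [Group G] [TopologicalSpace M] [CompactSpace M]
    [MulAction G M] [ContinuousConstSMul G M] [MulAction.IsMinimal G M] (φ : M ≃ₜ CantorSpace) :
    (transport (G := G) φ).IsMinimal := by
  intro U hU hne
  obtain ⟨x, hx⟩ := hne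
  obtain ⟨I, hI⟩ := isCompact_univ.exists_finite_cover_smul G (hU.preimage φ.continuous)
    ⟨φ.symm x, by simpa using hx⟩
  refine ⟨I, eq_univ_of_forall fun y => ?_⟩
  obtain ⟨g, hg, hy⟩ := mem_iUnion₂.1 (hI (mem_univ (φ.symm y)))
  obtain ⟨m, hm, hmy⟩ := hy
  refine mem_iUnion₂.2 ⟨g, hg, φ m, hm, ?_⟩
  rw [transport_apply, φ.symm_apply_apply]
  exact (congrArg φ hmy).trans (φ.apply_symm_apply y)

/-- The range is closed and invariant, so translates of its complement never reach it and cannot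
cover `Ω`. -/
theorem IsMinimal.surjective {G M : Type*} [Group G] [TopologicalSpace M] [CompactSpace M]
    [Nonempty M] [MulAction G M] {ξ : ActionSpace G} (hξ : ξ.IsMinimal) {f : M → CantorSpace}
    (hf : Continuous f) (hfξ : ∀ (g : G) m, f (g • m) = ξ g (f m)) : Function.Surjective f := by
  rw [← range_eq_univ]
  by_contra hne
  obtain ⟨F, hF⟩ := hξ (range f)ᶜ (isCompact_range hf).isClosed.isOpen_compl
    (nonempty_compl.2 hne)
  obtain ⟨m⟩ := ‹Nonempty M›
  obtain ⟨g, -, y, hy, hym⟩ := mem_iUnion₂.1 (hF.symm.subset (mem_univ (f m)))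
  refine hy ⟨g⁻¹ • m, ?_⟩
  rw [hfξ, ← hym, map_inv]
  exact (ξ g).symm_apply_apply y

/-! ### Marked spaces and the locally finite case -/

section LocallyFinite

variable {G : Type*} [Group G]

/-- The space of `Γ`-equivariant maps `G → Γ`, times the Cantor space with the action `ξ`. -/
abbrev MarkedSpace (Γ : Subgroup G) [TopologicalSpace Γ] [DiscreteTopology Γ] (ξ : ActionSpace G) :
    Type _ :=
  (coind (A := Γ) Γ).carrier × ActedSpace ξ

variable (Γ : Subgroup G) [TopologicalSpace Γ] [DiscreteTopology Γ] (ξ : ActionSpace G)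

/-- The equivariant projection of `MarkedSpace Γ ξ` onto `Γ`. -/
def marking (m : MarkedSpace Γ ξ) : Γ := m.1.1 1

theorem continuous_marking : Continuous (marking Γ ξ) :=
  (continuous_apply (1 : G)).comp (continuous_subtype_val.comp continuous_fst)

theorem marking_smul (γ : Γ) (m : MarkedSpace Γ ξ) :
    marking Γ ξ ((γ : G) • m) = γ * marking Γ ξ m := by
  change m.1.1 (1 * (γ : G)) = γ • m.1.1 1
  rw [one_mul, smul_apply_one_of_mem_coind Γ m.1.2]

instance : Nonempty (MarkedSpace Γ ξ) := by
  obtain ⟨T, hT, -⟩ := Γ.exists_isComplement_right 1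
  exact ⟨(⟨extendTransversal hT fun _ => 1, extendTransversal_mul hT _⟩,
    (fun _ => true : CantorSpace))⟩

end LocallyFinite

/-- A countably infinite locally finite group has an action with a clopen set met by every orbit,
together with its complement, along a fixed finite set. -/
theorem exists_syndetic_clopen {G : Type*} [Group G] [Countable G] [Infinite G]
    (hlf : IsLocallyFiniteGroup G) : ∃ (ξ : ActionSpace G) (c : Set CantorSpace) (F : Finset G),
      IsClopen c ∧ (∀ x, ∃ g ∈ F, ξ g x ∈ c) ∧ ∀ x, ∃ g ∈ F, ξ g x ∉ c := by
  classical
  obtain ⟨a, ha⟩ := exists_ne (1 : G)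
  let L : Subgroup G := Subgroup.closure (({a} : Finset G) : Set G)
  have hL : Finite L := hlf L ⟨_, rfl⟩
  have haL : a ∈ L := Subgroup.subset_closure (by simp)
  let _ : TopologicalSpace L := ⊥
  have : DiscreteTopology L := ⟨rfl⟩
  have := Fintype.ofFinite L
  let m₀ : MarkedSpace L (1 : ActionSpace G) := Classical.arbitrary _
  obtain ⟨φ, -⟩ := exists_homeomorph_cantorSpace (M := MarkedSpace L (1 : ActionSpace G))
    (fun _ => nontrivial_of_isOpen_prod) (fun _ _ => true) continuous_const 0
    (fun _ => ⟨m₀, fun i hi => absurd hi (Nat.not_lt_zero i)⟩)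
  -- The marking takes every value in `L` along each `L`-orbit, in particular `1` and `a ≠ 1`.
  have hval : ∀ (x : CantorSpace) (g : L), ∃ l ∈ Finset.univ.image fun l : L => (l : G),
      marking L 1 (φ.symm (transport (G := G) φ l x)) = g := by
    intro x g
    refine ⟨((g * (marking L 1 (φ.symm x))⁻¹ : L) : G), Finset.mem_image_of_mem _ (Finset.mem_univ _), ?_⟩
    rw [transport_apply, φ.symm_apply_apply, marking_smul, inv_mul_cancel_right]
  refine ⟨transport φ, {x | marking L 1 (φ.symm x) = 1}, Finset.univ.image fun l : L => (l : G),
    (isClopen_discrete {1}).preimage ((continuous_marking L 1).comp φ.symm.continuous),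
    fun x => hval x 1, fun x => ?_⟩
  obtain ⟨l, hl, hlx⟩ := hval x ⟨a, haL⟩
  refine ⟨l, hl, fun h => ha ?_⟩
  exact congrArg Subtype.val (hlx.symm.trans h)

theorem conjClass_not_residual_of_locallyFinite {G : Type*} [Group G] [Countable G] [Infinite G]
    (hlf : IsLocallyFiniteGroup G) (ξ : ActionSpace G) :
    conjClass ξ ∉ residual (ActionSpace G) := by
  intro hξ
  obtain ⟨ζ, c, F, hc, hF, hF'⟩ := exists_syndetic_clopen hlf
  have hev : ∀ᶠ η in 𝓝 ζ, ∀ g ∈ F, ∀ x, η g x ∈ c ↔ ζ g x ∈ c :=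
    (Finset.eventually_all F).2 fun g _ => eventually_mem_iff ζ g hc
  obtain ⟨N, hNsub, hN, hζN⟩ := mem_nhds_iff.1 hev
  obtain ⟨N', hN'N, hN', ⟨η, hη⟩, hconst⟩ :=
    exists_open_hitFamily_const continuous_id hξ hc hN ⟨ζ, hζN⟩
  have hηF : ∀ g ∈ F, ∀ x, η g x ∈ c ↔ ζ g x ∈ c := hNsub (hN'N hη)
  obtain ⟨Γ, hΓ, h⟩ := exists_finite_subgroup_realizations hlf η (hN'.mem_nhds hη) hc
    (fun x => (hF x).imp fun g hg => ⟨hg.1, (hηF g hg.1 x).2 hg.2⟩)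
    (fun x => (hF' x).imp fun g hg => ⟨hg.1, fun h => hg.2 ((hηF g hg.1 x).1 h)⟩)
  let _ : TopologicalSpace Γ := ⊥
  have : DiscreteTopology Γ := ⟨rfl⟩
  obtain ⟨φ₁, φ₂, h₁, h₂, hne⟩ := h (MarkedSpace Γ (1 : ActionSpace G))
    (fun _ => nontrivial_of_isOpen_prod) (marking Γ 1)
    ((IsLocallyConstant.iff_continuous _).2 (continuous_marking Γ 1)) (marking_smul Γ 1)
  exact hne (hconst _ h₁ _ h₂)

end ActionSpace

/-- Minimality itself makes `c` and its complement syndetic, so no special action is needed. The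
perturbations live on a minimal subset of the marked space over `η`. -/
theorem MinActionSpace.conjClass_not_residual_of_locallyFinite {G : Type*} [Group G] [Countable G]
    [Infinite G] (hlf : IsLocallyFiniteGroup G) (ξ : MinActionSpace G) :
    MinActionSpace.conjClass ξ ∉ residual (MinActionSpace G) := by
  intro hξ
  let c : Set CantorSpace := {x | x 0 = true}
  have hc : IsClopen c := (isClopen_discrete {true}).preimage (continuous_apply 0)
  obtain ⟨N, -, hN, ⟨η, hη⟩, hconst⟩ := ActionSpace.exists_open_hitFamily_const
    (X := MinActionSpace G) continuous_subtype_val hξ hc isOpen_univ ⟨ξ, trivial⟩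
  have hcover : ∀ U : Set CantorSpace, IsOpen U → U.Nonempty →
      ∃ F : Finset G, ∀ x, ∃ g ∈ F, η.1 g x ∈ U := by
    classical
    intro U hU hne
    obtain ⟨F, hF⟩ := η.2 U hU hne
    refine ⟨F.image fun g => g⁻¹, fun x => ?_⟩
    obtain ⟨g, hg, y, hy, rfl⟩ := mem_iUnion₂.1 (hF.symm.subset (mem_univ x))
    refine ⟨g⁻¹, Finset.mem_image_of_mem _ hg, ?_⟩
    rw [map_inv]
    have : (η.1 g)⁻¹ (η.1 g y) = y := (η.1 g).symm_apply_apply y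
    rwa [this]
  obtain ⟨F₁, hF₁⟩ := hcover c hc.isOpen ⟨fun _ => true, rfl⟩
  obtain ⟨F₂, hF₂⟩ := hcover cᶜ hc.compl.isOpen ⟨fun _ => false, fun h => Bool.false_ne_true h⟩
  classical
  obtain ⟨N₀, hN₀, rfl⟩ := isOpen_induced_iff.1 hN
  obtain ⟨Γ, hΓ, h⟩ := ActionSpace.exists_finite_subgroup_realizations hlf η.1
    (hN₀.mem_nhds hη) hc (F₀ := F₁ ∪ F₂)
    (fun x => (hF₁ x).imp fun g hg => ⟨Finset.mem_union_left _ hg.1, hg.2⟩)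
    (fun x => (hF₂ x).imp fun g hg => ⟨Finset.mem_union_right _ hg.1, hg.2⟩)
  let _ : TopologicalSpace Γ := ⊥
  have : DiscreteTopology Γ := ⟨rfl⟩
  obtain ⟨Z, hZ, hZne, hZmin⟩ :=
    exists_isMinimal_subMulAction (G := G) (X := ActionSpace.MarkedSpace Γ η.1)
  have : CompactSpace Z := isCompact_iff_compactSpace.1 hZ.isCompact
  have : Nonempty Z := hZne.to_subtype
  have : ContinuousConstSMul G Z :=
    ⟨fun g => Continuous.subtype_mk (continuous_subtype_val.const_smul g) _⟩
  have : SecondCountableTopology Z := IsEmbedding.subtypeVal.secondCountableTopology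
  -- The projection to `η` is onto by minimality of `η`; an infinite minimal system has no isolated
  -- points.
  have : Infinite Z := Infinite.of_surjective (β := CantorSpace) (fun z : Z => z.1.2)
    (η.2.surjective (M := Z) (f := fun z : Z => z.1.2) (continuous_snd.comp continuous_subtype_val) fun _ _ => rfl)
  obtain ⟨φ₁, φ₂, h₁, h₂, hne⟩ := h Z (fun _ => nontrivial_of_isOpen_of_isMinimal (G := G))
    (fun z => ActionSpace.marking Γ η.1 z.1)
    ((IsLocallyConstant.iff_continuous _).2
      ((ActionSpace.continuous_marking Γ η.1).comp continuous_subtype_val))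
    (fun γ z => ActionSpace.marking_smul Γ η.1 γ z.1)
  exact hne (hconst ⟨_, ActionSpace.isMinimal_transport φ₁⟩ h₁
    ⟨_, ActionSpace.isMinimal_transport φ₂⟩ h₂)

theorem corollary7p14 (G : Type*) [Group G] [Countable G]
    (hamen : IsAmenableGroup G) (hfg : ¬ Group.FG G) :
    (¬ ∃ ξ : ActionSpace G, ActionSpace.conjClass ξ ∈ residual (ActionSpace G)) ∧
    (IsLocallyFiniteGroup G →
      ¬ ∃ ξ : MinActionSpace G, MinActionSpace.conjClass ξ ∈ residual (MinActionSpace G)) := by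
  have : Infinite G := by
    by_contra h
    have := not_infinite_iff_finite.1 h
    exact hfg inferInstance
  refine ⟨fun ⟨ξ, hξ⟩ => ?_, fun hlf ⟨ξ, hξ⟩ => ?_⟩
  · by_cases hlf : IsLocallyFiniteGroup G
    · exact ActionSpace.conjClass_not_residual_of_locallyFinite hlf ξ hξ
    · exact ActionSpace.conjClass_not_residual_of_not_locallyFinite hamen hfg hlf ξ hξ
  · exact MinActionSpace.conjClass_not_residual_of_locallyFinite hlf ξ hξ
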